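/- Let $K$ be a commutative ring and $t\in K$. Let $\Lambda$ be the ring of symmetric formal power series of bounded degree in $x_1,x_2,\dots$ over $K$, and $\widehat\Lambda$ its completion (symmetric formal power series of arbitrary degree). Let $(\,,)\colon\widehat\Lambda\times\Lambda\to K$ be the Hall inner product, i.e. $\big(\sum_\lambda A_\lambda s_\lambda,\sum_\lambda B_\lambda s_\lambda\big)=\sum_\lambda A_\lambda B_\lambda$, where $s_\lambda$ are the Schur functions. For $F\in\widehat\Lambda$ let $F^\perp\colon\Lambda\to\Lambda$ be the map $F^\perp=((F,-)\otimes\mathrm{id})\circ\Delta$, where $\Delta f=f(x,y)$; that is, $F^\perp(f)=\sum (F,f_1)f_2$ if $f(x,y)=\sum f_1(x)f_2(y)$. Put $E(t)=\sum_{i\ge 0}t^ie_i\in\widehat\Lambda$. For partitions $\mu\subset\lambda$ let $g_{\lambda/\mu}=\sum_T x^T$ be the dual stable Grothendieck polynomial, where $T$ runs over the reverse plane partitions of shape $\lambda/\mu$ (fillings by positive integers weakly increasing along rows and columns) and the exponent of $x_i$ in $x^T$ is the number of columns of $T$ containing $i$; put $g_\lambda=g_{\lambda/\emptyset}$. Let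 $|\lambda/\mu|$ be the number of boxes and $c(\lambda/\mu)$ the number of (nonempty) columns of $\lambda/\mu$; $\lambda/\mu$ is a vertical strip if it has at most one box in each row. Then $E(t)^\perp$ is a $K$-algebra automorphism of $\Lambda$. For all partitions $\mu\subset\lambda$ one has $g_{\lambda/\mu}\in\Lambda$ and $$E(t)^\perp(g_{\lambda/\mu})=\sum_{\substack{\mu\subset\nu\subset\lambda\\ \lambda/\nu\text{ vertical strip}}}t^{c(\lambda/\nu)}(t+1)^{|\lambda/\nu|-c(\lambda/\nu)}\,g_{\nu/\mu}=\sum_{\substack{\mu\subset\nu\subset\lambda\\ \nu/\mu\text{ vertical strip}}}t^{c(\nu/\mu)}(t+1)^{|\nu/\mu|-c(\nu/\mu)}\,g_{\lambda/\nu}.$$ In particular, for every partition $\lambda$ with $\ell(\lambda)$ parts, $$E(t)^\perp(g_\lambda)=\sum_{\substack{\nu\subset\lambda\\ \lambda/\nu\text{ vertical strip}}}t^{c(\lambda/\nu)}(t+1)^{|\lambda/\nu|-c(\lambda/\nu)}\,g_\nu=g_\lambda+\sum_{k=1}^{\ell(\lambda)}t(t+1)^{k-1}g_{\lambda/(1^k)},$$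 where the last sum is empty for $\lambda=\emptyset$. -/

import Mathlib

namespace DualGrothendieck

noncomputable section

/-! ### Symmetric functions in the variables `x 0, x 1, x 2, …` -/

/-- `Λ̂`: the symmetric formal power series (of possibly unbounded degree). -/
def SymSeries (K : Type*) [CommRing K] : Subalgebra K (MvPowerSeries ℕ K) :=
  ⨅ σ : Equiv.Perm ℕ,
    AlgHom.equalizer (MvPowerSeries.renameEquiv K σ : MvPowerSeries ℕ K →ₐ[K] MvPowerSeries ℕ K)
      (AlgHom.id K _)

/-- The formal power series of bounded degree. -/
def BoundedSeries (K : Type*) [CommRing K] : Subalgebra K (MvPowerSeries ℕ K) where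
  carrier := {F | ∃ N : ℕ, ∀ α : ℕ →₀ ℕ, MvPowerSeries.coeff α F ≠ 0 → α.degree ≤ N}
  mul_mem' := by
    classical
    rintro F G ⟨M, hM⟩ ⟨N, hN⟩
    refine ⟨M + N, fun α h => ?_⟩
    rw [MvPowerSeries.coeff_mul] at h
    obtain ⟨p, hp, hne⟩ := Finset.exists_ne_zero_of_sum_ne_zero h
    rw [Finset.HasAntidiagonal.mem_antidiagonal] at hp
    have h1 := hM p.1 (left_ne_zero_of_mul hne)
    have h2 := hN p.2 (right_ne_zero_of_mul hne)
    rw [← hp, map_add]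
    omega
  add_mem' := by
    rintro F G ⟨M, hM⟩ ⟨N, hN⟩
    refine ⟨max M N, fun α h => ?_⟩
    by_contra hlt
    rw [not_le, max_lt_iff] at hlt
    apply h
    have h1 : MvPowerSeries.coeff α F = 0 := by
      by_contra h'
      exact absurd (hM α h') (by omega)
    have h2 : MvPowerSeries.coeff α G = 0 := by
      by_contra h'
      exact absurd (hN α h') (by omega)
    rw [map_add, h1, h2, add_zero]
  algebraMap_mem' := by
    classical
    intro r
    refine ⟨0, fun α h => ?_⟩
    rw [MvPowerSeries.algebraMap_apply, MvPowerSeries.coeff_C] at h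
    have : α = 0 := by
      by_contra h'
      exact h (if_neg h')
    simp [this]

/-- `Λ`: the symmetric formal power series of bounded degree. -/
def SymFun (K : Type*) [CommRing K] : Subalgebra K (MvPowerSeries ℕ K) :=
  SymSeries K ⊓ BoundedSeries K

section Lemmas

variable {K : Type*} [CommRing K]

theorem coeff_renameEquiv {ι κ : Type*} (σ : ι ≃ κ) (F : MvPowerSeries ι K) (α : ι →₀ ℕ) :
    MvPowerSeries.coeff (α.mapDomain σ) (MvPowerSeries.renameEquiv K σ F) =
      MvPowerSeries.coeff α F := by
  have h := MvPowerSeries.coeff_embDomain_rename (R := K) σ.toEmbedding F α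
  rw [Finsupp.embDomain_eq_mapDomain] at h
  exact h

theorem mem_symSeries_iff {F : MvPowerSeries ℕ K} :
    F ∈ SymSeries K ↔ ∀ (σ : Equiv.Perm ℕ) (α : ℕ →₀ ℕ),
      MvPowerSeries.coeff (α.mapDomain σ) F = MvPowerSeries.coeff α F := by
  simp only [SymSeries, Algebra.mem_iInf, AlgHom.mem_equalizer]
  refine forall_congr' fun σ => ?_
  constructor
  · intro h α
    have h' : MvPowerSeries.renameEquiv K σ F = F := h
    conv_lhs => rw [← h']
    exact coeff_renameEquiv σ F α
  · intro h
    change MvPowerSeries.renameEquiv K σ F = F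
    ext α
    have hα : (α.mapDomain σ.symm).mapDomain σ = α := by
      rw [← Finsupp.mapDomain_comp]
      simp
    rw [← hα, coeff_renameEquiv, h]

end Lemmas

/-! ### Schur functions and the Hall inner product -/

/-- The exponent vector of the monomial `x^T` of a semistandard tableau `T`. -/
def tableauWeight {lam : YoungDiagram} (T : SemistandardYoungTableau lam) : ℕ →₀ ℕ :=
  ∑ c ∈ lam.cells, Finsupp.single (T c.1 c.2) 1

/-- The Schur function `s_λ = ∑_T x^T`, summed over the semistandard tableaux of shape `λ`. -/
def schur (K : Type*) [CommRing K] (lam : YoungDiagram) : MvPowerSeries ℕ K :=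
  fun α => (Nat.card {T : SemistandardYoungTableau lam // tableauWeight T = α} : K)

variable {K : Type*} [CommRing K]

/-- `F = ∑_λ A_λ s_λ`, possibly an infinite sum. In every degree only finitely many `λ`
contribute, so each coefficient of the right hand side is a finite sum. -/
def IsSchurExpansion (F : MvPowerSeries ℕ K) (A : YoungDiagram → K) : Prop :=
  ∀ α : ℕ →₀ ℕ, MvPowerSeries.coeff α F =
    ∑ᶠ lam : YoungDiagram, A lam * MvPowerSeries.coeff α (schur K lam)

open Classical in
/-- The coefficients of the Schur expansion of `F`. Every symmetric series has
exactly one such expansion; the value `0` is used for series without one. -/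
def schurCoeff (F : MvPowerSeries ℕ K) : YoungDiagram → K :=
  if h : ∃! A : YoungDiagram → K, IsSchurExpansion F A then h.choose else 0

theorem schurCoeff_zero : schurCoeff (0 : MvPowerSeries ℕ K) = 0 := by
  unfold schurCoeff
  split_ifs with h
  · refine (h.choose_spec.2 0 fun α => ?_).symm
    simp
  · rfl

/-- The Hall inner product `( , ) : Λ̂ × Λ → K`, for which the Schur functions are orthonormal:
`(∑ A_λ s_λ, ∑ B_λ s_λ) = ∑ A_λ B_λ`, where only finitely many `B_λ` are nonzero. -/
def hall (F : SymSeries K) (f : SymFun K) : K :=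
  ∑ᶠ lam : YoungDiagram,
    schurCoeff (F : MvPowerSeries ℕ K) lam * schurCoeff (f : MvPowerSeries ℕ K) lam

theorem hall_zero (F : SymSeries K) : hall F 0 = 0 := by
  simp [hall, schurCoeff_zero]

/-! ### The maps `F^⊥` -/

/-- `f(x, y)`: the series `f` in the two alphabets `x 0, x 1, …` (indices `Sum.inl i`) and
`y 0, y 1, …` (indices `Sum.inr i`). For symmetric `f` the chosen bijection
`ℕ ≃ ℕ ⊕ ℕ` does not matter. -/
def twoAlphabets (f : MvPowerSeries ℕ K) : MvPowerSeries (ℕ ⊕ ℕ) K :=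
  MvPowerSeries.renameEquiv K Equiv.natSumNatEquivNat.symm f

/-- The coefficient of `y^β` in `f(x, y)`, as a series in `x`. -/
def yCoeff (f : MvPowerSeries ℕ K) (β : ℕ →₀ ℕ) : MvPowerSeries ℕ K :=
  fun α => MvPowerSeries.coeff (Finsupp.sumElim α β) (twoAlphabets f)

theorem coeff_yCoeff (f : MvPowerSeries ℕ K) (α β : ℕ →₀ ℕ) :
    MvPowerSeries.coeff α (yCoeff f β) =
      MvPowerSeries.coeff ((Finsupp.sumElim α β).mapDomain Equiv.natSumNatEquivNat) f := by
  change MvPowerSeries.coeff (Finsupp.sumElim α β) (twoAlphabets f) = _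
  rw [twoAlphabets, ← coeff_renameEquiv Equiv.natSumNatEquivNat.symm f,
    ← Finsupp.mapDomain_comp, Equiv.symm_comp_self, Finsupp.mapDomain_id]

theorem coeff_yCoeff_perm {f : MvPowerSeries ℕ K} (hf : f ∈ SymSeries K)
    (σ τ : Equiv.Perm ℕ) (α β : ℕ →₀ ℕ) :
    MvPowerSeries.coeff (α.mapDomain σ) (yCoeff f (β.mapDomain τ)) =
      MvPowerSeries.coeff α (yCoeff f β) := by
  rw [coeff_yCoeff, coeff_yCoeff]
  have h := mem_symSeries_iff.1 hf
    ((Equiv.natSumNatEquivNat.symm.trans (Equiv.sumCongr σ τ)).trans Equiv.natSumNatEquivNat)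
    ((Finsupp.sumElim α β).mapDomain Equiv.natSumNatEquivNat)
  rw [← h, ← Finsupp.mapDomain_comp]
  have h' : (Finsupp.sumElim (α.mapDomain σ) (β.mapDomain τ)) =
      (Finsupp.sumElim α β).mapDomain (Equiv.sumCongr σ τ) := by
    simp only [Finsupp.sumElim_eq_add, Finsupp.mapDomain_add, ← Finsupp.mapDomain_comp]
    rfl
  rw [h', ← Finsupp.mapDomain_comp]
  congr 3
  funext i
  simp only [Function.comp_apply, Equiv.trans_apply, Equiv.symm_apply_apply]

theorem degree_sumElim (α β : ℕ →₀ ℕ) :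
    ((Finsupp.sumElim α β).mapDomain Equiv.natSumNatEquivNat).degree = α.degree + β.degree := by
  rw [Finsupp.degree_mapDomain, Finsupp.sumElim_eq_add, map_add, Finsupp.degree_mapDomain,
    Finsupp.degree_mapDomain]

theorem yCoeff_mem (f : SymFun K) (β : ℕ →₀ ℕ) :
    yCoeff (f : MvPowerSeries ℕ K) β ∈ SymFun K := by
  obtain ⟨f, hs, N, hN⟩ := f
  refine ⟨?_, N, fun α h => ?_⟩
  · rw [SetLike.mem_coe, mem_symSeries_iff]
    intro σ α
    have := coeff_yCoeff_perm hs σ 1 α β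
    simpa using this
  · rw [coeff_yCoeff] at h
    have := hN _ h
    rw [degree_sumElim] at this
    omega

/-- The result of applying `(F, -)` to `f(x, y)` in the variables `x`: the series `∑_β (F, [y^β] f(x, y)) y^β`. -/
def perpSeries (F : SymSeries K) (f : SymFun K) : MvPowerSeries ℕ K :=
  fun β => hall F ⟨yCoeff (f : MvPowerSeries ℕ K) β, yCoeff_mem f β⟩

theorem perpSeries_mem (F : SymSeries K) (f : SymFun K) : perpSeries F f ∈ SymFun K := by
  have hs := f.2.1
  obtain ⟨N, hN⟩ := f.2.2
  refine ⟨?_, N, fun β h => ?_⟩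
  · rw [SetLike.mem_coe, mem_symSeries_iff]
    intro τ β
    change hall F _ = hall F _
    congr 2
    ext α
    have := coeff_yCoeff_perm hs 1 τ α β
    simpa using this
  · by_contra hlt
    apply h
    change hall F _ = 0
    rw [← hall_zero F]
    congr 1
    apply Subtype.ext
    ext α
    change MvPowerSeries.coeff α (yCoeff _ β) = 0
    rw [coeff_yCoeff]
    by_contra h'
    have := hN _ h'
    rw [degree_sumElim] at this
    omega

/-- `F^⊥ = ((F, -) ⊗ id) ∘ Δ : Λ → Λ`, where `Δ f = f(x, y)`. Expanding
`f(x, y) = ∑ f₁(x) f₂(y)` in powers of `y` shows that `∑ (F, f₁) f₂(y)` is obtained by applying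
`(F, -)` to the coefficient, in `Λ(x)`, of each monomial `y^β` of `f(x, y)`. -/
def perp (F : SymSeries K) (f : SymFun K) : SymFun K :=
  ⟨perpSeries F f, perpSeries_mem F f⟩

/-! ### The series `E(t)` -/

/-- The elementary symmetric function `e_i`: the sum of all squarefree monomials of degree `i`. -/
def elemSym (K : Type*) [CommRing K] (i : ℕ) : MvPowerSeries ℕ K :=
  fun α => if α.degree = i ∧ ∀ j ∈ α.support, α j = 1 then 1 else 0

/-- `∑_{i ≥ 0} t^i e_i`. The coefficient of `x^α` in `e_i` vanishes for `i > |α|`. -/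
def ESeries (t : K) : MvPowerSeries ℕ K :=
  fun α => ∑ i ∈ Finset.range (α.degree + 1), t ^ i * MvPowerSeries.coeff α (elemSym K i)

theorem coeff_elemSym_perm (i : ℕ) (σ : Equiv.Perm ℕ) (α : ℕ →₀ ℕ) :
    MvPowerSeries.coeff (α.mapDomain σ) (elemSym K i) = MvPowerSeries.coeff α (elemSym K i) := by
  change (if _ then _ else _) = (if _ then _ else _)
  congr 1
  have hdeg : (α.mapDomain σ).degree = α.degree := Finsupp.degree_mapDomain _ _
  rw [hdeg, ← Finsupp.equivMapDomain_eq_mapDomain]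
  simp only [Finsupp.mem_support_iff, Finsupp.equivMapDomain_apply, eq_iff_iff]
  refine and_congr_right fun _ => ⟨fun h j hj => ?_, fun h j hj => h _ hj⟩
  have := h (σ j)
  simpa using this (by simpa using hj)

/-- `E(t) = ∑_{i ≥ 0} t^i e_i ∈ Λ̂`. -/
def E (t : K) : SymSeries K :=
  ⟨ESeries t, by
    rw [mem_symSeries_iff]
    intro σ α
    have hdeg : (α.mapDomain σ).degree = α.degree := Finsupp.degree_mapDomain _ _
    change ∑ i ∈ Finset.range ((α.mapDomain σ).degree + 1),
        t ^ i * MvPowerSeries.coeff (α.mapDomain σ) (elemSym K i) =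
      ∑ i ∈ Finset.range (α.degree + 1), t ^ i * MvPowerSeries.coeff α (elemSym K i)
    rw [hdeg]
    exact Finset.sum_congr rfl fun i _ => by rw [coeff_elemSym_perm]⟩

/-! ### Skew shapes and dual stable Grothendieck polynomials -/

/-- The boxes `(row, column)` of the skew shape `λ/μ`. -/
def skewCells (lam mu : YoungDiagram) : Finset (ℕ × ℕ) :=
  lam.cells \ mu.cells

/-- `|λ/μ|`, the number of boxes. -/
def skewSize (lam mu : YoungDiagram) : ℕ :=
  (skewCells lam mu).card

/-- `c(λ/μ)`, the number of columns of `λ/μ` (those containing a box). -/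
def numColumns (lam mu : YoungDiagram) : ℕ :=
  ((skewCells lam mu).image Prod.snd).card

/-- `λ/μ` is a vertical strip: it has at most one box in each row. -/
def IsVerticalStrip (lam mu : YoungDiagram) : Prop :=
  ∀ c ∈ skewCells lam mu, ∀ d ∈ skewCells lam mu, c.1 = d.1 → c = d

instance (lam mu : YoungDiagram) : Decidable (IsVerticalStrip lam mu) := by
  unfold IsVerticalStrip
  infer_instance

/-- A reverse plane partition of shape `λ/μ`: a filling of the boxes that is weakly increasing in
every row and column. As the variables are `x 0, x 1, …`, the fillings are by natural numbers.
For extensionality the entries outside `λ/μ` are required to be `0`. -/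
structure ReversePlanePartition (lam mu : YoungDiagram) where
  entry : ℕ → ℕ → ℕ
  row_weak : ∀ {i j₁ j₂ : ℕ}, j₁ < j₂ → (i, j₁) ∈ skewCells lam mu →
    (i, j₂) ∈ skewCells lam mu → entry i j₁ ≤ entry i j₂
  col_weak : ∀ {i₁ i₂ j : ℕ}, i₁ < i₂ → (i₁, j) ∈ skewCells lam mu →
    (i₂, j) ∈ skewCells lam mu → entry i₁ j ≤ entry i₂ j
  zeros : ∀ {i j : ℕ}, (i, j) ∉ skewCells lam mu → entry i j = 0

/-- The exponent vector of `x^T`: the exponent of `x i` is the number of columns of `T` that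
contain `i`. -/
def ReversePlanePartition.weight {lam mu : YoungDiagram} (T : ReversePlanePartition lam mu) :
    ℕ →₀ ℕ :=
  ∑ p ∈ (skewCells lam mu).image (fun c => (T.entry c.1 c.2, c.2)), Finsupp.single p.1 1

/-- The dual stable Grothendieck polynomial `g_{λ/μ} = ∑_T x^T`, summed over the reverse plane
partitions `T` of shape `λ/μ`. -/
def dualG (K : Type*) [CommRing K] (lam mu : YoungDiagram) : MvPowerSeries ℕ K :=
  fun α => (Nat.card {T : ReversePlanePartition lam mu // T.weight = α} : K)

/-- The one-column shape `(1^k)`. -/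
def column (k : ℕ) : YoungDiagram where
  cells := Finset.range k ×ˢ {0}
  isLowerSet := by
    rintro ⟨a, b⟩ ⟨c, d⟩ ⟨h₁, h₂⟩ h
    simp only [Finset.coe_product, Finset.coe_range, Finset.coe_singleton, Set.mem_prod,
      Set.mem_Iio, Set.mem_singleton_iff] at h ⊢
    simp only at h₁ h₂
    omega

theorem finite_Icc_youngDiagram (mu lam : YoungDiagram) : (Set.Icc mu lam).Finite := by
  refine Set.Finite.of_finite_image (f := YoungDiagram.cells) ?_
    (fun a _ b _ h => YoungDiagram.ext h)
  refine (Finset.finite_toSet lam.cells.powerset).subset ?_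
  rintro _ ⟨nu, hnu, rfl⟩
  simpa using YoungDiagram.cells_subset_iff.2 hnu.2

/-- `Finset.Icc μ λ` is the set of all `ν` with `μ ⊂ ν ⊂ λ`. -/
instance : LocallyFiniteOrder YoungDiagram :=
  LocallyFiniteOrder.ofFiniteIcc finite_Icc_youngDiagram

/-- `t^{c(λ/ν)} (t+1)^{|λ/ν| - c(λ/ν)}`; note that `c(λ/ν) ≤ |λ/ν|`. -/
def stripCoeff (t : K) (lam nu : YoungDiagram) : K :=
  t ^ numColumns lam nu * (t + 1) ^ (skewSize lam nu - numColumns lam nu)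

end

end DualGrothendieck

namespace DualGrothendieck

noncomputable section

/-! ### Column coordinates of Young diagrams -/

/-! The identities are computed in the incidence algebra of Young's lattice. Let `C(y)` have entries
y^{c(λ/μ)} (`columnWeight`), and let `S(t)` have the vertical-strip entries t^c (t+1)^{|·|-c}
(`stripWeight`). In a reverse plane partition the boxes with the smallest possible entry fill some
ν/μ and contribute c(ν/μ) to the exponent of the first variable. Hence g_{λ/μ} is the entry at (μ,
λ) of a product of factors `C(x_i)`, and g_{λ/μ}(s, x_0, x_1, …) is obtained by multiplying by one
further factor `C(s)`.

The key fact is that `C(y)` and `S(t)` commute, and that they are mutually inverse for y = -t. In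
terms of column lengths, both products of `C(y)` and `S(t)` split into one factor per column. A
connected component of λ/μ with r columns and h rows contributes y^{r-1}(t+y)(t+1)^{h-1} in either
order; the two orders only attach the factor t+y to opposite ends of the component
(`prod_columnFactor_aux`). At y = -t every nonempty shape therefore gets 0. Since `C(x)` is the
inverse of `S(-x)`, it commutes with `C(y)`, and this makes g_{λ/μ} symmetric
(`dualGCoeff_mapDomain`).

On the side of Λ, the map f ↦ f(s, x_0, x_1, …) is visibly an algebra homomorphism, and E(t)^⊥ is
its inverse for s = -t. This reduces to (E(t), f(-t, x)) = f(0), which is checked on Schur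
functions: by the branching rule only the columns ν = (1^k) with λ/ν a horizontal strip count, and
for λ ≠ ∅ there are none or exactly two, which cancel (`hall_E_specialize_schurSym`). The basis
property of the Schur functions comes from unitriangularity of the Kostka numbers, and their
symmetry from that of g_λ, whose top-degree part is s_λ.

Since f ↦ f(-t, x) acts on all g_{λ/μ} as multiplication by `C(-t)`, on either side by
commutativity, its inverse acts as multiplication by `S(t)` on either side. These are the two
expansions. -/

theorem le_iff_colLen {mu lam : YoungDiagram} :
    mu ≤ lam ↔ ∀ j, mu.colLen j ≤ lam.colLen j := by
  constructor
  · intro h j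
    by_contra hlt
    rw [not_le] at hlt
    have h1 : (lam.colLen j, j) ∈ mu := YoungDiagram.mem_iff_lt_colLen.2 hlt
    exact lt_irrefl _ (YoungDiagram.mem_iff_lt_colLen.1 (h h1))
  · rintro h ⟨i, j⟩ hc
    exact YoungDiagram.mem_iff_lt_colLen.2 ((YoungDiagram.mem_iff_lt_colLen.1 hc).trans_le (h j))

theorem eq_of_colLen {mu lam : YoungDiagram} (h : ∀ j, mu.colLen j = lam.colLen j) : mu = lam :=
  le_antisymm (le_iff_colLen.2 fun j => (h j).le) (le_iff_colLen.2 fun j => (h j).ge)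

theorem mem_skewCells {lam mu : YoungDiagram} {c : ℕ × ℕ} :
    c ∈ skewCells lam mu ↔ mu.colLen c.2 ≤ c.1 ∧ c.1 < lam.colLen c.2 := by
  rw [skewCells, Finset.mem_sdiff, YoungDiagram.mem_cells, YoungDiagram.mem_cells]
  rw [YoungDiagram.mem_iff_lt_colLen (i := c.1) (j := c.2),
    YoungDiagram.mem_iff_lt_colLen (i := c.1) (j := c.2), not_lt, and_comm]

theorem colLen_eq_zero {lam : YoungDiagram} {j : ℕ} (h : lam.rowLen 0 ≤ j) : lam.colLen j = 0 := by
  by_contra hne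
  have : (0, j) ∈ lam := YoungDiagram.mem_iff_lt_colLen.2 (Nat.pos_of_ne_zero hne)
  exact absurd (YoungDiagram.mem_iff_lt_rowLen.1 this) (by omega)

theorem numColumns_eq_card {lam : YoungDiagram} (mu : YoungDiagram) {n : ℕ}
    (hn : lam.colLen n = 0) :
    numColumns lam mu = ((Finset.range n).filter fun j => mu.colLen j < lam.colLen j).card := by
  unfold numColumns
  congr 1
  ext j
  simp only [Finset.mem_image, Prod.exists, exists_eq_right, Finset.mem_filter, Finset.mem_range,
    mem_skewCells]
  constructor
  · rintro ⟨i, h1, h2⟩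
    refine ⟨?_, by omega⟩
    by_contra hj
    have := lam.colLen_anti n j (by omega)
    omega
  · rintro ⟨-, h⟩
    exact ⟨_, le_rfl, h⟩

theorem skewSize_eq_sum {lam : YoungDiagram} (mu : YoungDiagram) {n : ℕ}
    (hn : lam.colLen n = 0) :
    skewSize lam mu = ∑ j ∈ Finset.range n, (lam.colLen j - mu.colLen j) := by
  have h : skewCells lam mu = (Finset.range n).biUnion
      fun j => (Finset.Ico (mu.colLen j) (lam.colLen j)).image fun i => (i, j) := by
    ext ⟨i, j⟩
    simp only [mem_skewCells, Finset.mem_biUnion, Finset.mem_image, Finset.mem_Ico,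
      Finset.mem_range, Prod.mk.injEq]
    constructor
    · rintro h
      refine ⟨j, ?_, i, h, rfl, rfl⟩
      by_contra hj
      have := lam.colLen_anti n j (by omega)
      omega
    · rintro ⟨j', -, i', h, rfl, rfl⟩
      exact h
  rw [skewSize, h, Finset.card_biUnion]
  · refine Finset.sum_congr rfl fun j _ => ?_
    rw [Finset.card_image_of_injective _ fun a b hab => (Prod.mk.inj hab).1, Nat.card_Ico]
  · intro j _ j' _ hne
    rw [Function.onFun, Finset.disjoint_left]
    rintro c hc hc'
    rw [Finset.mem_image] at hc hc'
    obtain ⟨_, _, rfl⟩ := hc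
    obtain ⟨_, _, h'⟩ := hc'
    exact hne (Prod.mk.inj h').2.symm

/-- Two boxes of row i in columns j < j' would give μ'_j ≤ i < λ'_{j'} ≤ λ'_{j+1}, where primes
denote column lengths. Thus the condition only relates neighbouring columns. -/
theorem isVerticalStrip_iff {lam mu : YoungDiagram} :
    IsVerticalStrip lam mu ↔ ∀ j, lam.colLen (j + 1) ≤ mu.colLen j := by
  constructor
  · intro h j
    by_contra hlt
    rw [not_le] at hlt
    have h1 := lam.colLen_anti j (j + 1) (by omega)
    have h2 := mu.colLen_anti j (j + 1) (by omega)
    have := h (mu.colLen j, j) (mem_skewCells.2 ⟨le_rfl, by simp only; omega⟩)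
      (mu.colLen j, j + 1) (mem_skewCells.2 ⟨h2, hlt⟩) rfl
    simp at this
  · have key : ∀ {j j' i : ℕ}, (∀ j, lam.colLen (j + 1) ≤ mu.colLen j) → j < j' →
        mu.colLen j ≤ i → i < lam.colLen j' → False := by
      intro j j' i h hj h1 h2
      have := h j
      have := lam.colLen_anti (j + 1) j' hj
      omega
    rintro h ⟨i, j⟩ hc ⟨i', j'⟩ hd hij
    simp only at hij
    subst hij
    rw [mem_skewCells] at hc hd
    rcases lt_trichotomy j j' with hj | hj | hj
    · exact (key h hj hc.1 hd.2).elim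
    · rw [hj]
    · exact (key h hj hd.1 hc.2).elim

/-- The Young diagram with prescribed column lengths. -/
def ofColLens (f : ℕ → ℕ) (hf : Antitone f) (n : ℕ) (_ : f n = 0) : YoungDiagram where
  cells := (Finset.range (f 0) ×ˢ Finset.range n).filter fun c => c.1 < f c.2
  isLowerSet := by
    rintro ⟨a, b⟩ ⟨c, d⟩ ⟨h₁, h₂⟩ h
    simp only [Finset.coe_filter, Finset.mem_product, Finset.mem_range, Set.mem_ofPred_eq] at h ⊢
    simp only at h₁ h₂
    have := hf h₂
    omega

theorem colLen_ofColLens (f : ℕ → ℕ) (hf : Antitone f) (n : ℕ) (hn : f n = 0) (j : ℕ) :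
    (ofColLens f hf n hn).colLen j = f j := by
  have key : ∀ i, i < (ofColLens f hf n hn).colLen j ↔ i < f j := by
    intro i
    rw [← YoungDiagram.mem_iff_lt_colLen, ← YoungDiagram.mem_cells]
    simp only [ofColLens, Finset.mem_filter, Finset.mem_product, Finset.mem_range,
      and_iff_right_iff_imp]
    intro h
    have h0 := hf (Nat.zero_le j)
    refine ⟨by omega, ?_⟩
    by_contra hj
    have := hf (not_lt.1 hj)
    omega
  have h1 := key (f j)
  have h2 := key ((ofColLens f hf n hn).colLen j)
  omega

/-- The interlacing `hi (j + 1) ≤ lo j` makes every choice of column lengths in the intervals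
automatically antitone. The diagrams in `S` thus form a product of intervals, and distributivity
applies. -/
theorem sum_prod_colLen {R : Type*} [CommRing R] (lo hi : ℕ → ℕ) (n : ℕ)
    (hh : ∀ j, hi (j + 1) ≤ lo j) (hn : ∀ j, n ≤ j → hi j = 0) (S : Finset YoungDiagram)
    (hS : ∀ nu, nu ∈ S ↔ ∀ j, lo j ≤ nu.colLen j ∧ nu.colLen j ≤ hi j) (hl : ∀ j, lo j ≤ hi j)
    (F : ℕ → ℕ → R) :
    ∑ nu ∈ S, ∏ j ∈ Finset.range n, F j (nu.colLen j) =
      ∏ j ∈ Finset.range n, ∑ m ∈ Finset.Icc (lo j) (hi j), F j m := by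
  rw [Finset.prod_range, Finset.prod_univ_sum]
  refine Finset.sum_bij (fun nu _ j => nu.colLen j) ?_ ?_ ?_ ?_
  · intro nu hnu
    rw [Fintype.mem_piFinset]
    intro j
    rw [Finset.mem_Icc]
    exact (hS nu).1 hnu j
  · intro nu hnu nu' hnu' h
    refine eq_of_colLen fun j => ?_
    by_cases hj : j < n
    · exact congrFun h ⟨j, hj⟩
    · have h1 := ((hS nu).1 hnu j).2
      have h2 := ((hS nu').1 hnu' j).2
      have := hn j (by omega)
      omega
  · intro p hp
    rw [Fintype.mem_piFinset] at hp
    set f : ℕ → ℕ := fun j => if h : j < n then p ⟨j, h⟩ else 0 with hf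
    have hb : ∀ j, lo j ≤ f j ∧ f j ≤ hi j := by
      intro j
      by_cases hj : j < n
      · simpa [hf, hj] using hp ⟨j, hj⟩
      · have := hl j
        have := hn j (by omega)
        simp only [hf, hj, dif_neg, not_false_eq_true]
        omega
    have ha : Antitone f := antitone_nat_of_succ_le fun j =>
      ((hb (j + 1)).2.trans (hh j)).trans (hb j).1
    refine ⟨ofColLens f ha n (by simp [hf]), ?_, ?_⟩
    · rw [hS]
      simpa only [colLen_ofColLens] using hb
    · funext j
      rw [colLen_ofColLens]
      simp [hf]
  · intro nu _
    rw [Finset.prod_range]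

/-! ### The weights of vertical strips, column by column -/

section Weights

variable {R : Type*} [CommRing R] (t y : R)

/-- The contribution `t (t+1)^{r-1}` of a column with `r > 0` boxes to `stripCoeff`. -/
def columnCoeff (r : ℕ) : R := if r = 0 then 1 else t * (t + 1) ^ (r - 1)

/-- The sum telescopes, as t(t+1)^k = (t+1)^{k+1} - (t+1)^k. -/
theorem sum_columnCoeff (k : ℕ) :
    ∑ r ∈ Finset.range (k + 1), columnCoeff t r = (t + 1) ^ k := by
  induction k with
  | zero => simp [columnCoeff]
  | succ k ih =>
    rw [Finset.sum_range_succ, ih]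
    simp only [columnCoeff, Nat.add_eq_zero_iff, one_ne_zero, and_false, if_false,
      Nat.add_sub_cancel]
    ring

theorem sum_Icc_columnCoeff_sub_left {a b : ℕ} (h : a ≤ b) :
    ∑ m ∈ Finset.Icc a b, columnCoeff t (m - a) = (t + 1) ^ (b - a) := by
  rw [← sum_columnCoeff, ← Finset.Ico_add_one_right_eq_Icc, Finset.sum_Ico_eq_sum_range,
    Nat.sub_add_comm h]
  exact Finset.sum_congr rfl fun r _ => by rw [Nat.add_sub_cancel_left]

theorem sum_Icc_columnCoeff_sub_right {a b : ℕ} (h : a ≤ b) :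
    ∑ m ∈ Finset.Icc a b, columnCoeff t (b - m) = (t + 1) ^ (b - a) := by
  rw [← sum_columnCoeff, ← Finset.Ico_add_one_right_eq_Icc, Finset.sum_Ico_eq_sum_range,
    Nat.sub_add_comm h, ← Finset.sum_range_reflect]
  refine Finset.sum_congr rfl fun r hr => ?_
  rw [Finset.mem_range] at hr
  congr 1
  omega

/-- A column with r > 0 boxes adds 1 to c and r - 1 to |·| - c; an empty column adds nothing to
either. -/
theorem stripCoeff_eq_prod {lam mu : YoungDiagram} {n : ℕ} (hn : lam.colLen n = 0) :
    stripCoeff t lam mu =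
      ∏ j ∈ Finset.range n, columnCoeff t (lam.colLen j - mu.colLen j) := by
  have h : ∀ r, columnCoeff t r = t ^ (if 0 < r then 1 else 0) * (t + 1) ^ (r - 1) := by
    intro r
    rcases Nat.eq_zero_or_pos r with rfl | hr
    · simp [columnCoeff]
    · simp [columnCoeff, hr, hr.ne']
  have hcol : numColumns lam mu =
      ∑ j ∈ Finset.range n, if 0 < lam.colLen j - mu.colLen j then 1 else 0 := by
    rw [numColumns_eq_card mu hn, Finset.card_filter]
    exact Finset.sum_congr rfl fun j _ => by simp only [tsub_pos_iff_lt]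
  have hsize : skewSize lam mu - numColumns lam mu =
      ∑ j ∈ Finset.range n, (lam.colLen j - mu.colLen j - 1) := by
    rw [hcol, skewSize_eq_sum mu hn, Nat.sub_eq_iff_eq_add (Finset.sum_le_sum fun j _ => by
      split_ifs <;> omega), ← Finset.sum_add_distrib]
    refine Finset.sum_congr rfl fun j _ => ?_
    split_ifs <;> omega
  simp only [h]
  rw [stripCoeff, hsize, hcol, Finset.prod_mul_distrib, Finset.prod_pow_eq_pow_sum,
    Finset.prod_pow_eq_pow_sum]

theorem pow_numColumns_eq_prod {lam : YoungDiagram} (mu : YoungDiagram) {n : ℕ}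
    (hn : lam.colLen n = 0) :
    y ^ numColumns lam mu =
      ∏ j ∈ Finset.range n, if mu.colLen j < lam.colLen j then y else 1 := by
  rw [numColumns_eq_card mu hn, Finset.prod_ite, Finset.prod_const, Finset.prod_const_one, mul_one]

/-- The total weight of the ways to remove boxes from (or add boxes to) a single column, of length
`L` in `λ` and `M` in `μ`. If `linked`, the neighbouring column allows only `k < L - M` boxes. -/
def columnFactor (L M : ℕ) (linked : Prop) [Decidable linked] (k : ℕ) : R :=
  if L = M then 1 else if linked then y * (t + 1) ^ k else (t + y) * (t + 1) ^ (L - M - 1)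

/-- Here m is the column length in ν and N the next column length of λ, below which a vertical strip
cannot cut. If M < N, the box count of ν/μ in this column is never zero and y factors out. Otherwise
m = M is the one term without y; it supplies the t in t + y. -/
theorem sum_remove_column {L N M : ℕ} (hN : N ≤ L) (hM : M ≤ L) :
    ∑ m ∈ Finset.Icc (max N M) L, columnCoeff t (L - m) * (if M < m then y else 1) =
      columnFactor t y L M (M < N) (L - N) := by
  unfold columnFactor
  split_ifs with h1 h2
  · subst h1
    simp [hN, columnCoeff]
  · rw [max_eq_left h2.le, ← sum_Icc_columnCoeff_sub_right t hN, Finset.mul_sum]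
    refine Finset.sum_congr rfl fun m hm => ?_
    rw [Finset.mem_Icc] at hm
    rw [if_pos (by omega), mul_comm]
  · have hlt : M < L := by omega
    rw [max_eq_right (by omega), ← Finset.add_sum_Ioc_eq_sum_Icc hM, if_neg (lt_irrefl _), mul_one,
      ← Finset.Icc_add_one_left_eq_Ioc, add_mul]
    congr 1
    · rw [columnCoeff, if_neg (by omega)]
    · rw [Nat.sub_sub, ← sum_Icc_columnCoeff_sub_right t (Nat.succ_le_of_lt hlt), Finset.mul_sum]
      refine Finset.sum_congr rfl fun m hm => ?_
      rw [Finset.mem_Icc] at hm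
      rw [if_pos (by omega), mul_comm]

/-- The mirror image of `sum_remove_column`: N is now the previous column length of μ, above which a
vertical strip cannot grow, and the term without y is m = L. -/
theorem sum_add_column {L N M : ℕ} (hN : M ≤ N) (hM : M ≤ L) :
    ∑ m ∈ Finset.Icc M (min N L), (if m < L then y else 1) * columnCoeff t (m - M) =
      columnFactor t y L M (N < L) (N - M) := by
  unfold columnFactor
  split_ifs with h1 h2
  · subst h1
    simp [hN, columnCoeff]
  · rw [min_eq_left h2.le, ← sum_Icc_columnCoeff_sub_left t hN, Finset.mul_sum]
    refine Finset.sum_congr rfl fun m hm => ?_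
    rw [Finset.mem_Icc] at hm
    rw [if_pos (by omega)]
  · obtain ⟨L', rfl⟩ : ∃ L', L = L' + 1 := ⟨L - 1, by omega⟩
    have hM' : M ≤ L' := by omega
    rw [min_eq_right (by omega), Finset.sum_Icc_succ_top hM, if_neg (lt_irrefl _), one_mul,
      add_mul, add_comm]
    congr 1
    · rw [columnCoeff, if_neg (by omega)]
    · rw [show L' + 1 - M - 1 = L' - M by omega, ← sum_Icc_columnCoeff_sub_left t hM',
        Finset.mul_sum]
      refine Finset.sum_congr rfl fun m hm => ?_
      rw [Finset.mem_Icc] at hm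
      rw [if_pos (by omega)]

/-- The bound on the length of column `j` that is imposed by column `j - 1` of `μ`. -/
def previous (L M : ℕ → ℕ) : ℕ → ℕ
  -- Column 0 has no left neighbour: the value `L 0` makes the upper bound vacuous and the link
  -- condition false.
  | 0 => L 0
  | j + 1 => M j

/-- Columns j and j + 1 are linked when they share a row, and runs of linked columns are the
components of the shape. The first product puts t + y at the right end of a run, the second at its
left end. So the partial products agree up to a common `Z`, except inside an unfinished run, where
the first still has y in place of the factor t + y and its powers of t + 1 are distributed
differently. -/
theorem prod_columnFactor_aux {L M : ℕ → ℕ} (hL : Antitone L) (hM : Antitone M)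
    (hLM : ∀ j, M j ≤ L j) (n : ℕ) :
    ∃ Z : R,
      ∏ j ∈ Finset.range n, columnFactor t y (L j) (M j) (M j < L (j + 1)) (L j - L (j + 1)) =
        Z * (if previous L M n < L n then y else 1) ∧
      ∏ j ∈ Finset.range n,
          columnFactor t y (L j) (M j) (previous L M j < L j) (previous L M j - M j) =
        Z * (if previous L M n < L n then (t + y) * (t + 1) ^ (L n - previous L M n - 1)
          else 1) := by
  induction n with
  | zero => exact ⟨1, by simp [previous]⟩
  | succ n ih =>
    obtain ⟨Z, h1, h2⟩ := ih
    have hl := hL (Nat.le_succ n)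
    have hlm := hLM n
    have hlm' := hLM (n + 1)
    have hm := hM (Nat.le_succ n)
    have hp : M n ≤ previous L M n := by
      cases n with
      | zero => exact hLM 0
      | succ k => exact hM (Nat.le_succ k)
    rw [Finset.prod_range_succ, Finset.prod_range_succ, h1, h2]
    have hps : previous L M (n + 1) = M n := rfl
    rw [hps]
    simp only [Nat.succ_eq_add_one] at hl hm
    generalize previous L M n = p at *
    unfold columnFactor
    by_cases hd : L n = M n
    · refine ⟨Z, ?_⟩
      simp [hd, show ¬ p < M n by omega, show ¬ M n < L (n + 1) by omega]
    · simp only [if_neg hd]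
      by_cases hk : M n < L (n + 1)
      · refine ⟨Z * (if p < L n then y else 1) * (t + 1) ^ (L n - L (n + 1)), ?_⟩
        simp only [if_pos hk]
        refine ⟨by ring, ?_⟩
        by_cases hq : p < L n
        · simp only [if_pos hq]
          -- Both exponents add up to L n - M n - 1, the number of boxes of column n minus one; the
          -- bookkeeping in the other cases is of the same kind.
          have e : (t + 1) ^ (L n - p - 1) * (t + 1) ^ (p - M n) =
              (t + 1) ^ (L n - L (n + 1)) * (t + 1) ^ (L (n + 1) - M n - 1) := by
            rw [← pow_add, ← pow_add]
            congr 1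
            omega
          linear_combination (Z * (t + y) * y) * e
        · simp only [if_neg hq]
          have e : (t + 1) ^ (L n - M n - 1) =
              (t + 1) ^ (L n - L (n + 1)) * (t + 1) ^ (L (n + 1) - M n - 1) := by
            rw [← pow_add]
            congr 1
            omega
          linear_combination (Z * (t + y)) * e
      · refine ⟨Z * (if p < L n then y else 1) * ((t + y) * (t + 1) ^ (L n - M n - 1)), ?_⟩
        simp only [if_neg hk]
        refine ⟨by ring, ?_⟩
        by_cases hq : p < L n
        · simp only [if_pos hq]
          have e : (t + 1) ^ (L n - p - 1) * (t + 1) ^ (p - M n) =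
              (t + 1) ^ (L n - M n - 1) := by
            rw [← pow_add]
            congr 1
            omega
          linear_combination (Z * (t + y) * y) * e
        · simp only [if_neg hq]
          ring

theorem prod_columnFactor_eq {L M : ℕ → ℕ} (hL : Antitone L) (hM : Antitone M)
    (hLM : ∀ j, M j ≤ L j) {n : ℕ} (hn : L n = 0) :
    ∏ j ∈ Finset.range n, columnFactor t y (L j) (M j) (M j < L (j + 1)) (L j - L (j + 1)) =
      ∏ j ∈ Finset.range n,
        columnFactor t y (L j) (M j) (previous L M j < L j) (previous L M j - M j) := by
  obtain ⟨Z, h1, h2⟩ := prod_columnFactor_aux t y hL hM hLM n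
  rw [h1, h2, hn]
  simp

/-- The rightmost nonempty column is not linked to its right neighbour, so it carries the factor t +
y, which is 0 for y = -t. -/
theorem prod_columnFactor_neg {L M : ℕ → ℕ} (hM : Antitone M) (hLM : ∀ j, M j ≤ L j) {n : ℕ}
    (hn : ∀ j, n ≤ j → L j = 0) (hne : L ≠ M) :
    ∏ j ∈ Finset.range n,
      columnFactor t (-t) (L j) (M j) (M j < L (j + 1)) (L j - L (j + 1)) = 0 := by
  have hex : ∃ j, L j ≠ M j := Function.ne_iff.1 hne
  have hlt : ∀ j, L j ≠ M j → j < n := by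
    intro j hj
    by_contra h
    have := hn j (by omega)
    have := hLM j
    omega
  obtain ⟨j, hj, hmax⟩ : ∃ j, L j ≠ M j ∧ ∀ k, j < k → L k = M k := by
    classical
    obtain ⟨j0, hj0⟩ := hex
    refine ⟨Nat.findGreatest (fun j => L j ≠ M j) n,
      Nat.findGreatest_spec (P := fun j => L j ≠ M j) (hlt j0 hj0).le hj0, fun k hk => ?_⟩
    by_contra h
    exact Nat.findGreatest_is_greatest hk (hlt k h).le h
  refine Finset.prod_eq_zero (Finset.mem_range.2 (hlt j hj)) ?_
  have h1 := hmax (j + 1) (by omega)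
  have h2 := hM (Nat.le_succ j)
  rw [columnFactor, if_neg hj, if_neg (by simp only [Nat.succ_eq_add_one] at h2; omega)]
  simp

end Weights

/-! ### The incidence algebra of Young's lattice -/

section Incidence

variable {R : Type*} [CommRing R]

open Classical in
/-- The element `y^{c(λ/μ)}` of the incidence algebra. -/
def columnWeight (y : R) : IncidenceAlgebra R YoungDiagram where
  toFun mu lam := if mu ≤ lam then y ^ numColumns lam mu else 0
  eq_zero_of_not_le' _ _ h := if_neg h

open Classical in
/-- The element `stripCoeff t λ μ`, supported on vertical strips, of the incidence algebra. -/
def stripWeight (t : R) : IncidenceAlgebra R YoungDiagram where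
  toFun mu lam := if mu ≤ lam then (if IsVerticalStrip lam mu then stripCoeff t lam mu else 0) else 0
  eq_zero_of_not_le' _ _ h := if_neg h

theorem columnWeight_apply (y : R) {mu lam : YoungDiagram} (h : mu ≤ lam) :
    columnWeight y mu lam = y ^ numColumns lam mu := if_pos h

theorem stripWeight_apply (t : R) {mu lam : YoungDiagram} (h : mu ≤ lam) :
    stripWeight t mu lam = if IsVerticalStrip lam mu then stripCoeff t lam mu else 0 := by
  exact if_pos h

instance : DecidableEq YoungDiagram := Classical.decEq _

theorem columnWeight_mul_stripWeight_apply (t y : R) {mu lam : YoungDiagram} (h : mu ≤ lam)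
    {n : ℕ} (hn : lam.colLen n = 0) :
    (columnWeight y * stripWeight t) mu lam = ∏ j ∈ Finset.range n,
      columnFactor t y (lam.colLen j) (mu.colLen j) (mu.colLen j < lam.colLen (j + 1))
        (lam.colLen j - lam.colLen (j + 1)) := by
  have hc := le_iff_colLen.1 h
  have hn' : ∀ j, n ≤ j → lam.colLen j = 0 := fun j hj => by
    have := lam.colLen_anti n j hj
    omega
  rw [IncidenceAlgebra.mul_apply]
  rw [Finset.sum_congr rfl fun nu hnu => by
    rw [columnWeight_apply y (Finset.mem_Icc.1 hnu).1, stripWeight_apply t (Finset.mem_Icc.1 hnu).2,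
      mul_ite, mul_zero], ← Finset.sum_filter]
  rw [Finset.prod_congr rfl fun j _ => (sum_remove_column t y
    (lam.colLen_anti j (j + 1) (Nat.le_succ j)) (hc j)).symm, ← sum_prod_colLen
    (fun j => max (lam.colLen (j + 1)) (mu.colLen j)) (fun j => lam.colLen j) n
    (fun j => le_max_left _ _) hn'
    ((Finset.Icc mu lam).filter fun nu => IsVerticalStrip lam nu) ?_
    (fun j => max_le (lam.colLen_anti j (j + 1) (Nat.le_succ j)) (hc j))
    (fun j m => columnCoeff t (lam.colLen j - m) * (if mu.colLen j < m then y else 1))]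
  · refine Finset.sum_congr rfl fun nu hnu => ?_
    have hle := (Finset.mem_Icc.1 (Finset.mem_filter.1 hnu).1).2
    have hz : nu.colLen n = 0 := by
      have := le_iff_colLen.1 hle n
      omega
    rw [Finset.prod_mul_distrib, stripCoeff_eq_prod t hn, pow_numColumns_eq_prod y mu hz, mul_comm]
  · intro nu
    rw [Finset.mem_filter, Finset.mem_Icc, isVerticalStrip_iff, le_iff_colLen, le_iff_colLen]
    simp only [max_le_iff]
    exact ⟨fun h j => ⟨⟨h.2 j, h.1.1 j⟩, h.1.2 j⟩,
      fun h => ⟨⟨fun j => (h j).1.2, fun j => (h j).2⟩, fun j => (h j).1.1⟩⟩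

theorem stripWeight_mul_columnWeight_apply (t y : R) {mu lam : YoungDiagram} (h : mu ≤ lam)
    {n : ℕ} (hn : lam.colLen n = 0) :
    (stripWeight t * columnWeight y) mu lam = ∏ j ∈ Finset.range n,
      columnFactor t y (lam.colLen j) (mu.colLen j)
        (previous lam.colLen mu.colLen j < lam.colLen j)
        (previous lam.colLen mu.colLen j - mu.colLen j) := by
  have hc := le_iff_colLen.1 h
  have hn' : ∀ j, n ≤ j → lam.colLen j = 0 := fun j hj => by
    have := lam.colLen_anti n j hj
    omega
  have hprev : ∀ j, mu.colLen j ≤ previous lam.colLen mu.colLen j := by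
    intro j
    cases j with
    | zero => exact hc 0
    | succ j => exact mu.colLen_anti j (j + 1) (Nat.le_succ j)
  rw [IncidenceAlgebra.mul_apply]
  rw [Finset.sum_congr rfl fun nu hnu => by
    rw [columnWeight_apply y (Finset.mem_Icc.1 hnu).2, stripWeight_apply t (Finset.mem_Icc.1 hnu).1,
      ite_mul, zero_mul], ← Finset.sum_filter]
  rw [Finset.prod_congr rfl fun j _ => (sum_add_column t y (hprev j) (hc j)).symm,
    ← sum_prod_colLen
    (fun j => mu.colLen j) (fun j => min (previous lam.colLen mu.colLen j) (lam.colLen j)) n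
    (fun j => min_le_left _ _) (fun j hj => by rw [hn' j hj, Nat.min_zero])
    ((Finset.Icc mu lam).filter fun nu => IsVerticalStrip nu mu) ?_
    (fun j => le_min (hprev j) (hc j))
    (fun j m => (if m < lam.colLen j then y else 1) * columnCoeff t (m - mu.colLen j))]
  · refine Finset.sum_congr rfl fun nu hnu => ?_
    have hle := (Finset.mem_Icc.1 (Finset.mem_filter.1 hnu).1).2
    have hz : nu.colLen n = 0 := by
      have := le_iff_colLen.1 hle n
      omega
    rw [Finset.prod_mul_distrib, stripCoeff_eq_prod t hz, pow_numColumns_eq_prod y nu hn, mul_comm]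
  · intro nu
    rw [Finset.mem_filter, Finset.mem_Icc, isVerticalStrip_iff, le_iff_colLen, le_iff_colLen]
    simp only [le_min_iff]
    refine ⟨fun h j => ⟨h.1.1 j, ?_, h.1.2 j⟩,
      fun h => ⟨⟨fun j => (h j).1, fun j => (h j).2.2⟩, fun j => (h (j + 1)).2.1⟩⟩
    cases j with
    | zero => exact h.1.2 0
    | succ j => exact h.2 j

/-! ### Commutation and inversion of the column and strip elements. -/

theorem columnWeight_mul_stripWeight_comm (t y : R) :
    columnWeight y * stripWeight t = stripWeight t * columnWeight y := by
  ext mu lam h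
  have hn : lam.colLen (lam.rowLen 0) = 0 := colLen_eq_zero le_rfl
  rw [columnWeight_mul_stripWeight_apply t y h hn, stripWeight_mul_columnWeight_apply t y h hn]
  exact prod_columnFactor_eq t y (fun _ _ => lam.colLen_anti _ _) (fun _ _ => mu.colLen_anti _ _)
    (le_iff_colLen.1 h) hn

theorem columnWeight_neg_mul_stripWeight (t : R) : columnWeight (-t) * stripWeight t = 1 := by
  ext mu lam h
  have hn : ∀ j, lam.rowLen 0 ≤ j → lam.colLen j = 0 := fun _ => colLen_eq_zero
  rw [columnWeight_mul_stripWeight_apply t (-t) h (hn _ le_rfl), IncidenceAlgebra.one_apply]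
  split_ifs with he
  · subst he
    exact Finset.prod_eq_one fun j _ => by simp [columnFactor]
  · exact prod_columnFactor_neg t (fun _ _ => mu.colLen_anti _ _) (le_iff_colLen.1 h) hn
      fun h' => he (eq_of_colLen fun j => (congrFun h' j).symm)

theorem stripWeight_mul_columnWeight_neg (t : R) : stripWeight t * columnWeight (-t) = 1 := by
  rw [← columnWeight_mul_stripWeight_comm, columnWeight_neg_mul_stripWeight]

/-- An element commuting with an invertible element commutes with its inverse; here `columnWeight x`
is the inverse of `stripWeight (-x)`. -/
theorem columnWeight_comm (x y : R) :
    columnWeight x * columnWeight y = columnWeight y * columnWeight x := by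
  have h1 : columnWeight x * stripWeight (-x) = 1 := by
    simpa using columnWeight_neg_mul_stripWeight (-x)
  have h2 : stripWeight (-x) * columnWeight x = 1 := by
    simpa using stripWeight_mul_columnWeight_neg (-x)
  calc columnWeight x * columnWeight y
      = columnWeight x * (columnWeight y * stripWeight (-x)) * columnWeight x := by
        rw [mul_assoc, mul_assoc, h2, mul_one]
    _ = columnWeight y * columnWeight x := by
        rw [columnWeight_mul_stripWeight_comm, ← mul_assoc, h1, one_mul]

open Classical in
/-- The element of the incidence algebra that indicates `c(λ/μ) = b`. -/
def columnIndicator (R : Type*) [CommRing R] (b : ℕ) : IncidenceAlgebra R YoungDiagram where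
  toFun mu lam := if mu ≤ lam then (if numColumns lam mu = b then 1 else 0) else 0
  eq_zero_of_not_le' _ _ h := if_neg h

theorem columnIndicator_apply (b : ℕ) {mu lam : YoungDiagram} (h : mu ≤ lam) :
    columnIndicator R b mu lam = if numColumns lam mu = b then 1 else 0 := by
  exact if_pos h

/-- Compare coefficients in `columnWeight_comm` over ℤ[X][X]: the inner variable records one column
number and the outer variable the other. -/
theorem card_filter_numColumns (mu lam : YoungDiagram) (a b : ℕ) :
    ((Finset.Icc mu lam).filter fun nu => numColumns nu mu = a ∧ numColumns lam nu = b).card =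
      ((Finset.Icc mu lam).filter fun nu => numColumns nu mu = b ∧ numColumns lam nu = a).card := by
  open Polynomial in
  have h := congrArg (fun p : ℤ[X][X] => (p.coeff b).coeff a) (congrArg
    (fun f : IncidenceAlgebra ℤ[X][X] YoungDiagram => f mu lam) (columnWeight_comm (C X) X))
  simp only [IncidenceAlgebra.mul_apply, Polynomial.finsetSum_coeff] at h
  have key : ∀ c d : ℕ, (((Polynomial.C Polynomial.X : Polynomial (Polynomial ℤ)) ^ c *
      Polynomial.X ^ d).coeff b).coeff a = if c = a ∧ d = b then 1 else 0 := by
    intro c d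
    rw [← Polynomial.C_pow, Polynomial.coeff_C_mul, Polynomial.coeff_X_pow]
    by_cases h1 : d = b
    · by_cases h2 : c = a
      · simp [h1, h2]
      · simp [h1, h2, Polynomial.coeff_X_pow, Ne.symm h2]
    · simp [h1, Ne.symm h1]
  rw [Finset.card_filter, Finset.card_filter]
  zify
  convert h using 1 <;> refine Finset.sum_congr rfl fun nu hnu => ?_
  · rw [columnWeight_apply _ (Finset.mem_Icc.1 hnu).1,
      columnWeight_apply _ (Finset.mem_Icc.1 hnu).2, key]
    simp
  · rw [columnWeight_apply _ (Finset.mem_Icc.1 hnu).1,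
      columnWeight_apply _ (Finset.mem_Icc.1 hnu).2, mul_comm, key]
    simp [and_comm]

theorem columnIndicator_comm (a b : ℕ) :
    Commute (columnIndicator R a) (columnIndicator R b) := by
  have key : ∀ (a b : ℕ) (mu lam : YoungDiagram),
      (columnIndicator R a * columnIndicator R b) mu lam = (((Finset.Icc mu lam).filter
        fun nu => numColumns nu mu = a ∧ numColumns lam nu = b).card : R) := by
    intro a b mu lam
    rw [IncidenceAlgebra.mul_apply, ← Finset.sum_boole]
    refine Finset.sum_congr rfl fun nu hnu => ?_
    rw [columnIndicator_apply _ (Finset.mem_Icc.1 hnu).1,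
      columnIndicator_apply _ (Finset.mem_Icc.1 hnu).2, ite_and, ite_mul, one_mul, zero_mul]
  ext mu lam _
  rw [key, key, card_filter_numColumns]

/-- A shape without columns is empty. Consequently variables with exponent 0 contribute trivially,
and a product over infinitely many variables reduces to the support of the exponent vector. -/
theorem columnIndicator_zero : columnIndicator R 0 = 1 := by
  ext mu lam h
  rw [columnIndicator_apply 0 h, IncidenceAlgebra.one_apply]
  congr 1
  rw [numColumns_eq_card mu (colLen_eq_zero (le_refl (lam.rowLen 0))), Finset.card_eq_zero,
    Finset.filter_eq_empty_iff, eq_iff_iff]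
  constructor
  · intro hj
    refine eq_of_colLen fun j => ?_
    have h1 := le_iff_colLen.1 h j
    by_cases hlt : j < lam.rowLen 0
    · have := hj (Finset.mem_range.2 hlt)
      omega
    · have := colLen_eq_zero (not_lt.1 hlt)
      omega
  · rintro rfl j _
    exact lt_irrefl _

end Incidence

/-! ### Prepending an exponent -/

/-- The exponent vector `(b, β 0, β 1, …)`. -/
def consExp (b : ℕ) (β : ℕ →₀ ℕ) : ℕ →₀ ℕ :=
  Finsupp.single 0 b + β.mapDomain Nat.succ

@[simp] theorem consExp_apply_zero (b : ℕ) (β : ℕ →₀ ℕ) : consExp b β 0 = b := by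
  rw [consExp, Finsupp.add_apply, Finsupp.single_eq_same, Finsupp.mapDomain_of_notMem_range, add_zero]
  simp

@[simp] theorem consExp_apply_succ (b : ℕ) (β : ℕ →₀ ℕ) (i : ℕ) : consExp b β (i + 1) = β i := by
  rw [consExp, Finsupp.add_apply, Finsupp.single_eq_of_ne (by simp), zero_add]
  exact Finsupp.mapDomain_apply Nat.succ_injective β i

theorem consExp_inj {b b' : ℕ} {β β' : ℕ →₀ ℕ} :
    consExp b β = consExp b' β' ↔ b = b' ∧ β = β' := by
  refine ⟨fun h => ⟨?_, ?_⟩, fun h => by rw [h.1, h.2]⟩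
  · simpa using DFunLike.congr_fun h 0
  · ext i
    simpa using DFunLike.congr_fun h (i + 1)

theorem eq_consExp_iff {α β : ℕ →₀ ℕ} {b : ℕ} :
    α = consExp b β ↔ α 0 = b ∧ ∀ i, α (i + 1) = β i := by
  refine ⟨fun h => by simp [h], fun h => ?_⟩
  ext i
  cases i with
  | zero => simpa using h.1
  | succ i => simpa using h.2 i

theorem exists_eq_consExp (α : ℕ →₀ ℕ) : ∃ b β, α = consExp b β :=
  ⟨α 0, α.comapDomain Nat.succ Nat.succ_injective.injOn, by simp [eq_consExp_iff]⟩

theorem degree_consExp (b : ℕ) (β : ℕ →₀ ℕ) : (consExp b β).degree = b + β.degree := by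
  rw [consExp, map_add, Finsupp.degree_single, Finsupp.degree_mapDomain]

theorem consExp_zero_zero : consExp 0 0 = 0 := by
  simp [consExp]

theorem consExp_induction {P : (ℕ →₀ ℕ) → Prop} (zero : P 0)
    (cons : ∀ b β, P β → P (consExp b β)) (α : ℕ →₀ ℕ) : P α := by
  have key : ∀ n (α : ℕ →₀ ℕ), (∀ k, n ≤ k → α k = 0) → P α := by
    intro n
    induction n with
    | zero =>
      intro α h
      rwa [show α = 0 from Finsupp.ext fun k => h k (Nat.zero_le k)]
    | succ n ih =>
      intro α h
      obtain ⟨b, β, rfl⟩ := exists_eq_consExp α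
      refine cons b β (ih β fun k hk => ?_)
      simpa using h (k + 1) (by omega)
  refine key (α.support.sup id + 1) α fun k hk => ?_
  by_contra h
  have := Finset.le_sup (f := id) (Finsupp.mem_support_iff.2 h)
  simp only [id] at this
  omega

theorem prod_consExp {M : Type*} [CommMonoid M] (h : ℕ → M) (h0 : h 0 = 1) (b : ℕ)
    (β : ℕ →₀ ℕ) :
    ((consExp b β).prod fun _ k => h k) = h b * β.prod fun _ k => h k := by
  classical
  rw [consExp, Finsupp.prod_add_index_of_disjoint, Finsupp.prod_single_index h0,
    Finsupp.prod_mapDomain_index_inj Nat.succ_injective]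
  refine Finset.disjoint_of_subset_left Finsupp.support_single_subset ?_
  rw [Finset.disjoint_singleton_left]
  intro h
  obtain ⟨k, -, hk⟩ := Finset.mem_image.1 (Finsupp.mapDomain_support h)
  exact Nat.succ_ne_zero k hk

/-! ### Reverse plane partitions -/

namespace ReversePlanePartition

variable {lam mu nu : YoungDiagram}

theorem ext_entry {T T' : ReversePlanePartition lam mu} (h : ∀ i j, T.entry i j = T'.entry i j) :
    T = T' := by
  cases T
  cases T'
  congr
  funext i j
  exact h i j

theorem entry_mono (T : ReversePlanePartition lam mu) {i i' j j' : ℕ} (hi : i ≤ i') (hj : j ≤ j')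
    (h : (i, j) ∈ skewCells lam mu) (h' : (i', j') ∈ skewCells lam mu) :
    T.entry i j ≤ T.entry i' j' := by
  -- Skew shapes are convex: the corner lies in λ because (i', j') does, and outside μ because (i,
  -- j) does.
  have hm : (i, j') ∈ skewCells lam mu := by
    rw [skewCells, Finset.mem_sdiff, YoungDiagram.mem_cells, YoungDiagram.mem_cells] at *
    exact ⟨lam.up_left_mem hi le_rfl h'.1, fun hc => h.2 (mu.up_left_mem le_rfl hj hc)⟩
  calc T.entry i j ≤ T.entry i j' := by
        rcases hj.eq_or_lt with rfl | hlt
        · exact le_rfl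
        · exact T.row_weak hlt h hm
    _ ≤ T.entry i' j' := by
        rcases hi.eq_or_lt with rfl | hlt
        · exact le_rfl
        · exact T.col_weak hlt hm h'

theorem weight_apply (T : ReversePlanePartition lam mu) (k : ℕ) :
    T.weight k =
      (((skewCells lam mu).filter fun c => T.entry c.1 c.2 = k).image Prod.snd).card := by
  rw [weight, Finsupp.finsetSum_apply]
  simp only [Finsupp.single_apply]
  rw [← Finset.card_filter]
  refine Finset.card_bij (fun p _ => p.2) ?_ ?_ ?_
  · rintro ⟨a, b⟩ hp
    simp only [Finset.mem_filter, Finset.mem_image, Prod.mk.injEq] at hp ⊢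
    obtain ⟨⟨c, hc, h1, h2⟩, h3⟩ := hp
    exact ⟨c, ⟨hc, h1.trans h3⟩, h2⟩
  · rintro ⟨a, b⟩ hp ⟨a', b'⟩ hp' h
    simp only [Finset.mem_filter] at hp hp' h
    rw [h, hp.2, hp'.2]
  · rintro b hb
    simp only [Finset.mem_filter, Finset.mem_image] at hb ⊢
    obtain ⟨c, ⟨hc, h1⟩, h2⟩ := hb
    exact ⟨(k, b), ⟨⟨c, hc, by rw [h1, h2]⟩, rfl⟩, rfl⟩

theorem degree_weight (T : ReversePlanePartition lam mu) :
    T.weight.degree =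
      ((skewCells lam mu).image fun c => (T.entry c.1 c.2, c.2)).card := by
  rw [weight, map_sum, Finset.card_eq_sum_ones]
  exact Finset.sum_congr rfl fun _ _ => Finsupp.degree_single _ _

theorem degree_weight_le (T : ReversePlanePartition lam mu) :
    T.weight.degree ≤ skewSize lam mu := by
  rw [degree_weight]
  exact Finset.card_image_le

theorem weight_entry_ne_zero (T : ReversePlanePartition lam mu) {c : ℕ × ℕ}
    (hc : c ∈ skewCells lam mu) : T.weight (T.entry c.1 c.2) ≠ 0 := by
  rw [weight_apply, Finset.card_ne_zero]
  exact ⟨c.2, Finset.mem_image_of_mem _ (Finset.mem_filter.2 ⟨hc, rfl⟩)⟩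

/-- Every entry occurs with positive exponent, so the entries lie in the finite support of α.
Without finiteness `Nat.card` would be 0 and could not be summed. -/
instance finite_weight (α : ℕ →₀ ℕ) :
    Finite {T : ReversePlanePartition lam mu // T.weight = α} := by
  let f : {T : ReversePlanePartition lam mu // T.weight = α} → (skewCells lam mu → α.support) :=
    fun T c => ⟨T.1.entry c.1.1 c.1.2, by
      obtain ⟨T, rfl⟩ := T
      exact Finsupp.mem_support_iff.2 (T.weight_entry_ne_zero c.2)⟩
  refine Finite.of_injective f ?_
  rintro ⟨T, hT⟩ ⟨T', hT'⟩ h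
  refine Subtype.ext (ext_entry fun i j => ?_)
  by_cases hc : (i, j) ∈ skewCells lam mu
  · exact congrArg Subtype.val (congrFun h ⟨(i, j), hc⟩)
  · rw [T.zeros hc, T'.zeros hc]

theorem skewCells_mono (h : mu ≤ nu) : skewCells lam nu ⊆ skewCells lam mu :=
  Finset.sdiff_subset_sdiff le_rfl (YoungDiagram.cells_subset_iff.2 h)

/-- Raise the entries of a reverse plane partition of shape `λ/ν` by one, and fill `ν/μ`
with zeros. -/
def extend (hmu : mu ≤ nu) (T : ReversePlanePartition lam nu) : ReversePlanePartition lam mu where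
  entry i j := if (i, j) ∈ skewCells lam nu then T.entry i j + 1 else 0
  row_weak := by
    intro i j₁ j₂ hj h1 h2
    split_ifs with h3 h4
    · exact Nat.succ_le_succ (T.row_weak hj h3 h4)
    · simp only [skewCells, Finset.mem_sdiff, YoungDiagram.mem_cells] at h1 h2 h3 h4
      exact (h4 ⟨h2.1, fun hc => h3.2 (nu.up_left_mem le_rfl hj.le hc)⟩).elim
    · exact Nat.zero_le _
    · exact le_rfl
  col_weak := by
    intro i₁ i₂ j hi h1 h2
    split_ifs with h3 h4
    · exact Nat.succ_le_succ (T.col_weak hi h3 h4)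
    · simp only [skewCells, Finset.mem_sdiff, YoungDiagram.mem_cells] at h1 h2 h3 h4
      exact (h4 ⟨h2.1, fun hc => h3.2 (nu.up_left_mem hi.le le_rfl hc)⟩).elim
    · exact Nat.zero_le _
    · exact le_rfl
  zeros := fun h => if_neg fun h' => h (skewCells_mono hmu h')

theorem filter_extend_zero (hmu : mu ≤ nu) (hnu : nu ≤ lam) (T : ReversePlanePartition lam nu) :
    ((skewCells lam mu).filter fun c => (T.extend hmu).entry c.1 c.2 = 0) = skewCells nu mu := by
  ext ⟨i, j⟩
  simp only [extend, Finset.mem_filter, ite_eq_right_iff, Nat.succ_ne_zero, imp_false, skewCells,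
    Finset.mem_sdiff, YoungDiagram.mem_cells]
  have := @hnu (i, j)
  tauto

theorem filter_extend_succ (hmu : mu ≤ nu) (T : ReversePlanePartition lam nu) (k : ℕ) :
    ((skewCells lam mu).filter fun c => (T.extend hmu).entry c.1 c.2 = k + 1) =
      (skewCells lam nu).filter fun c => T.entry c.1 c.2 = k := by
  ext ⟨i, j⟩
  rw [Finset.mem_filter, Finset.mem_filter]
  simp only [extend]
  constructor
  · rintro ⟨h1, h2⟩
    split_ifs at h2 with h3
    exact ⟨h3, by omega⟩
  · rintro ⟨h1, h2⟩
    exact ⟨skewCells_mono hmu h1, by rw [if_pos h1, h2]⟩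

theorem weight_extend (hmu : mu ≤ nu) (hnu : nu ≤ lam) (T : ReversePlanePartition lam nu) :
    (T.extend hmu).weight = consExp (numColumns nu mu) T.weight := by
  rw [eq_consExp_iff]
  refine ⟨?_, fun k => ?_⟩
  · rw [weight_apply, filter_extend_zero hmu hnu, numColumns]
  · rw [weight_apply, filter_extend_succ, weight_apply]

/-- The shape ν is recovered as μ together with the boxes with entry zero. -/
theorem extend_injective {nu' : YoungDiagram} (hmu : mu ≤ nu) (hnu : nu ≤ lam) (hmu' : mu ≤ nu')
    (hnu' : nu' ≤ lam) {T : ReversePlanePartition lam nu} {T' : ReversePlanePartition lam nu'}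
    (h : T.extend hmu = T'.extend hmu') : nu = nu' ∧ HEq T T' := by
  have hs : skewCells nu mu = skewCells nu' mu := by
    rw [← filter_extend_zero hmu hnu T, h, filter_extend_zero hmu' hnu' T']
  have he : nu = nu' := by
    apply YoungDiagram.ext
    rw [← Finset.sdiff_union_of_subset (YoungDiagram.cells_subset_iff.2 hmu),
      ← Finset.sdiff_union_of_subset (YoungDiagram.cells_subset_iff.2 hmu')]
    exact congrArg (· ∪ mu.cells) hs
  subst he
  refine ⟨rfl, heq_of_eq (ext_entry fun i j => ?_)⟩
  by_cases hc : (i, j) ∈ skewCells lam nu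
  · have := congrArg (fun T : ReversePlanePartition lam mu => T.entry i j) h
    simpa [extend, hc] using this
  · rw [T.zeros hc, T'.zeros hc]

/-- By monotonicity the zeros of T form, together with μ, a lower set, which serves as ν; the
remaining entries are positive and can be lowered by one. -/
theorem exists_extend (hle : mu ≤ lam) (T : ReversePlanePartition lam mu) :
    ∃ (nu : YoungDiagram) (hmu : mu ≤ nu) (_ : nu ≤ lam) (T' : ReversePlanePartition lam nu),
      T'.extend hmu = T := by
  let nu : YoungDiagram :=
    { cells := mu.cells ∪ (skewCells lam mu).filter fun c => T.entry c.1 c.2 = 0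
      isLowerSet := by
        rintro ⟨a, b⟩ ⟨c, d⟩ ⟨h₁, h₂⟩ h
        simp only [Finset.coe_union, Finset.coe_filter, Set.mem_union, Finset.mem_coe,
          YoungDiagram.mem_cells, Set.mem_ofPred_eq] at h h₁ h₂ ⊢
        by_cases hc : (c, d) ∈ mu
        · exact Or.inl hc
        · right
          rcases h with h | ⟨h, h0⟩
          · exact (hc (mu.up_left_mem h₁ h₂ h)).elim
          · have hs : (c, d) ∈ skewCells lam mu := by
              rw [skewCells, Finset.mem_sdiff, YoungDiagram.mem_cells, YoungDiagram.mem_cells] at *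
              exact ⟨lam.up_left_mem h₁ h₂ h.1, hc⟩
            exact ⟨hs, Nat.le_zero.1 (h0 ▸ T.entry_mono h₁ h₂ hs h)⟩ }
  have hmem : ∀ c, c ∈ skewCells lam nu ↔ c ∈ skewCells lam mu ∧ T.entry c.1 c.2 ≠ 0 := by
    intro c
    simp only [skewCells, nu, Finset.mem_sdiff, Finset.mem_union, Finset.mem_filter]
    tauto
  have hmu : mu ≤ nu := YoungDiagram.cells_subset_iff.1 Finset.subset_union_left
  refine ⟨nu, hmu, ?_, ⟨fun i j => T.entry i j - 1, ?_, ?_, ?_⟩, ?_⟩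
  · exact YoungDiagram.cells_subset_iff.1 (Finset.union_subset (YoungDiagram.cells_subset_iff.2 hle)
      ((Finset.filter_subset _ _).trans Finset.sdiff_subset))
  · intro i j₁ j₂ hj h1 h2
    exact Nat.sub_le_sub_right (T.row_weak hj ((hmem _).1 h1).1 ((hmem _).1 h2).1) 1
  · intro i₁ i₂ j hi h1 h2
    exact Nat.sub_le_sub_right (T.col_weak hi ((hmem _).1 h1).1 ((hmem _).1 h2).1) 1
  · intro i j h
    rw [hmem] at h
    by_cases hc : (i, j) ∈ skewCells lam mu
    · have : T.entry i j = 0 := by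
        by_contra h'
        exact h ⟨hc, h'⟩
      rw [this]
    · rw [T.zeros hc]
  · refine ext_entry fun i j => ?_
    simp only [extend]
    split_ifs with h
    · have := ((hmem _).1 h).2
      simp only at this
      omega
    · rw [hmem] at h
      by_cases hc : (i, j) ∈ skewCells lam mu
      · by_contra h'
        exact h ⟨hc, fun h0 => h' h0.symm⟩
      · rw [T.zeros hc]

/-- Sort the fillings by the diagram ν whose part outside μ holds the zeros: the exponent of the
first variable is c(ν/μ), and the rest is a filling of λ/ν. -/
theorem card_weight_consExp (hle : mu ≤ lam) (b : ℕ) (β : ℕ →₀ ℕ) :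
    Nat.card {T : ReversePlanePartition lam mu // T.weight = consExp b β} =
      ∑ nu ∈ (Finset.Icc mu lam).filter fun nu => numColumns nu mu = b,
        Nat.card {T : ReversePlanePartition lam nu // T.weight = β} := by
  set S := (Finset.Icc mu lam).filter fun nu => numColumns nu mu = b with hS
  have hS' : ∀ nu : S, mu ≤ nu.1 ∧ nu.1 ≤ lam ∧ numColumns nu.1 mu = b := by
    rintro ⟨nu, h⟩
    rw [hS, Finset.mem_filter, Finset.mem_Icc] at h
    exact ⟨h.1.1, h.1.2, h.2⟩
  rw [← Finset.sum_coe_sort, ← Nat.card_sigma]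
  symm
  refine Nat.card_congr (Equiv.ofBijective (fun p => ⟨p.2.1.extend (hS' p.1).1, ?_⟩) ⟨?_, ?_⟩)
  · rw [weight_extend _ (hS' p.1).2.1, (hS' p.1).2.2, p.2.2]
  · rintro ⟨⟨nu, hnu⟩, T, hT⟩ ⟨⟨nu', hnu'⟩, T', hT'⟩ h
    obtain ⟨rfl, hh⟩ := extend_injective (hS' ⟨nu, hnu⟩).1 (hS' ⟨nu, hnu⟩).2.1
      (hS' ⟨nu', hnu'⟩).1 (hS' ⟨nu', hnu'⟩).2.1 (congrArg Subtype.val h)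
    obtain rfl := eq_of_heq hh
    rfl
  · rintro ⟨T, hT⟩
    obtain ⟨nu, hmu, hnu, T', rfl⟩ := T.exists_extend hle
    rw [weight_extend hmu hnu, consExp_inj] at hT
    exact ⟨⟨⟨nu, Finset.mem_filter.2 ⟨Finset.mem_Icc.2 ⟨hmu, hnu⟩, hT.1⟩⟩, T', hT.2⟩, rfl⟩

theorem card_weight_zero (hle : mu ≤ lam) :
    Nat.card {T : ReversePlanePartition lam mu // T.weight = 0} = if mu = lam then 1 else 0 := by
  split_ifs with h
  · subst h
    have he : skewCells mu mu = ∅ := Finset.sdiff_self _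
    rw [Nat.card_eq_one_iff_unique]
    refine ⟨⟨fun T T' => Subtype.ext (ext_entry fun i j => ?_)⟩,
      ⟨⟨fun _ _ => 0, fun _ _ _ => le_rfl, fun _ _ _ => le_rfl, fun _ => rfl⟩, ?_⟩⟩
    · rw [T.1.zeros (by simp [he]), T'.1.zeros (by simp [he])]
    · simp [weight, he]
  · rw [Nat.card_eq_zero]
    refine Or.inl ⟨fun T => ?_⟩
    have hne : (skewCells lam mu).Nonempty := by
      rw [skewCells, Finset.sdiff_nonempty, YoungDiagram.cells_subset_iff]
      exact fun h' => h (le_antisymm hle h')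
    obtain ⟨c, hc⟩ := hne
    exact T.1.weight_entry_ne_zero hc (by rw [T.2]; rfl)

end ReversePlanePartition

/-! ### Dual stable Grothendieck polynomials in the incidence algebra -/

section DualG

variable {K : Type*} [CommRing K]

theorem coeff_dualG (lam mu : YoungDiagram) (α : ℕ →₀ ℕ) :
    MvPowerSeries.coeff α (dualG K lam mu) =
      (Nat.card {T : ReversePlanePartition lam mu // T.weight = α} : K) := rfl

theorem degree_le_of_coeff_dualG_ne_zero {lam mu : YoungDiagram} {α : ℕ →₀ ℕ}
    (h : MvPowerSeries.coeff α (dualG K lam mu) ≠ 0) : α.degree ≤ skewSize lam mu := by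
  rw [coeff_dualG] at h
  have hne : Nonempty {T : ReversePlanePartition lam mu // T.weight = α} := by
    by_contra hemp
    rw [not_nonempty_iff] at hemp
    exact h (by simp)
  obtain ⟨T, rfl⟩ := hne
  exact T.degree_weight_le

open Classical in
/-- The coefficients of `x^α` in all `g_{λ/μ}`, as an element of the incidence algebra. -/
def dualGCoeff (K : Type*) [CommRing K] (α : ℕ →₀ ℕ) : IncidenceAlgebra K YoungDiagram where
  toFun mu lam := if mu ≤ lam then MvPowerSeries.coeff α (dualG K lam mu) else 0
  eq_zero_of_not_le' _ _ h := if_neg h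

theorem dualGCoeff_apply (α : ℕ →₀ ℕ) {mu lam : YoungDiagram} (h : mu ≤ lam) :
    dualGCoeff K α mu lam = MvPowerSeries.coeff α (dualG K lam mu) := if_pos h

theorem dualGCoeff_zero : dualGCoeff K 0 = 1 := by
  ext mu lam h
  rw [dualGCoeff_apply 0 h, coeff_dualG, ReversePlanePartition.card_weight_zero h,
    IncidenceAlgebra.one_apply]
  split_ifs <;> simp

theorem dualGCoeff_consExp (b : ℕ) (β : ℕ →₀ ℕ) :
    dualGCoeff K (consExp b β) = columnIndicator K b * dualGCoeff K β := by
  ext mu lam h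
  rw [dualGCoeff_apply _ h, coeff_dualG, ReversePlanePartition.card_weight_consExp h,
    IncidenceAlgebra.mul_apply, Nat.cast_sum, Finset.sum_filter]
  refine Finset.sum_congr rfl fun nu hnu => ?_
  rw [columnIndicator_apply _ (Finset.mem_Icc.1 hnu).1, dualGCoeff_apply _ (Finset.mem_Icc.1 hnu).2,
    coeff_dualG, ite_mul, one_mul, zero_mul]

theorem dualGCoeff_commute (b : ℕ) (α : ℕ →₀ ℕ) :
    Commute (columnIndicator K b) (dualGCoeff K α) := by
  induction α using consExp_induction with
  | zero => rw [dualGCoeff_zero]; exact Commute.one_right _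
  | cons b' β ih => rw [dualGCoeff_consExp]; exact (columnIndicator_comm b b').mul_right ih

open scoped IsMulCommutative in
-- Iterating `dualGCoeff_consExp` writes the coefficient of x^α as the product of the indicators
-- with column numbers α_i. These commute, so the product can be formed in the commutative subring
-- they generate, where the order of the variables is irrelevant.
theorem dualGCoeff_mapDomain (σ : Equiv.Perm ℕ) (α : ℕ →₀ ℕ) :
    dualGCoeff K (α.mapDomain σ) = dualGCoeff K α := by
  have hcomm : ∀ a ∈ Set.range (columnIndicator K), ∀ b ∈ Set.range (columnIndicator K),
      a * b = b * a := by
    rintro _ ⟨a, rfl⟩ _ ⟨b, rfl⟩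
    exact columnIndicator_comm a b
  have := Subring.isMulCommutative_closure hcomm
  let A : ℕ → Subring.closure (Set.range (columnIndicator K)) :=
    fun b => ⟨columnIndicator K b, Subring.subset_closure ⟨b, rfl⟩⟩
  have hA : A 0 = 1 := Subtype.ext columnIndicator_zero
  have key : ∀ α : ℕ →₀ ℕ, dualGCoeff K α = ((α.prod fun _ b => A b :
      Subring.closure (Set.range (columnIndicator K))) : IncidenceAlgebra K YoungDiagram) := by
    intro α
    induction α using consExp_induction with
    | zero => rw [dualGCoeff_zero, Finsupp.prod_zero_index]; rfl
    | cons b β ih => rw [dualGCoeff_consExp, prod_consExp A hA, ih]; rfl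
  rw [key, key, Finsupp.prod_mapDomain_index_inj σ.injective]

theorem dualG_mem {lam mu : YoungDiagram} (h : mu ≤ lam) : dualG K lam mu ∈ SymFun K := by
  refine ⟨?_, skewSize lam mu, fun α hα => degree_le_of_coeff_dualG_ne_zero hα⟩
  rw [SetLike.mem_coe, mem_symSeries_iff]
  intro σ α
  rw [← dualGCoeff_apply _ h, ← dualGCoeff_apply _ h, dualGCoeff_mapDomain]

end DualG

/-! ### Specializing the first variable of a symmetric function -/

section Specialize

variable {K : Type*} [CommRing K]

/-- On the finite support of γ the two injections differ by a partial bijection, which extends to a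
permutation of ℕ. -/
theorem coeff_mapDomain_eq {f : MvPowerSeries ℕ K} (hf : f ∈ SymSeries K) {ι : Type*}
    (γ : ι →₀ ℕ) {u v : ι → ℕ} (hu : Function.Injective u) (hv : Function.Injective v) :
    MvPowerSeries.coeff (γ.mapDomain u) f = MvPowerSeries.coeff (γ.mapDomain v) f := by
  obtain ⟨σ, hσ⟩ := Equiv.Perm.exists_extending_pair (fun i : γ.support => u i)
    (fun i : γ.support => v i) (hu.comp Subtype.val_injective) (hv.comp Subtype.val_injective)
  rw [← mem_symSeries_iff.1 hf σ, ← Finsupp.mapDomain_comp]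
  congr 2
  exact Finsupp.mapDomain_congr fun i hi => hσ ⟨i, hi⟩

/-- The isolated variable is treated as one more point, `none`, of the index set, which reduces this
to `coeff_mapDomain_eq`. -/
theorem coeff_single_add_mapDomain_eq {f : MvPowerSeries ℕ K} (hf : f ∈ SymSeries K) {ι : Type*}
    (b : ℕ) (γ : ι →₀ ℕ) {u v : ι → ℕ} {k l : ℕ} (hu : Function.Injective u)
    (hv : Function.Injective v) (hk : ∀ i, u i ≠ k) (hl : ∀ i, v i ≠ l) :
    MvPowerSeries.coeff (Finsupp.single k b + γ.mapDomain u) f =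
      MvPowerSeries.coeff (Finsupp.single l b + γ.mapDomain v) f := by
  have key : ∀ (w : ι → ℕ) (m : ℕ), Finsupp.single m b + γ.mapDomain w =
      (Finsupp.single none b + γ.mapDomain some).mapDomain (fun o : Option ι => o.elim m w) := by
    intro w m
    rw [Finsupp.mapDomain_add, Finsupp.mapDomain_single, ← Finsupp.mapDomain_comp]
    rfl
  have hinj : ∀ (w : ι → ℕ) (m : ℕ), Function.Injective w → (∀ i, w i ≠ m) →
      Function.Injective (fun o : Option ι => o.elim m w) := by
    rintro w m hw hm (_ | i) (_ | j) h
    · rfl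
    · exact (hm j h.symm).elim
    · exact (hm i h).elim
    · exact congrArg some (hw h)
  rw [key, key]
  exact coeff_mapDomain_eq hf _ (hinj u k hu hk) (hinj v l hv hl)

theorem consExp_eq_zero {b : ℕ} {β : ℕ →₀ ℕ} : consExp b β = 0 ↔ b = 0 ∧ β = 0 :=
  ⟨fun h => consExp_inj.1 (h.trans consExp_zero_zero.symm),
    fun h => by rw [h.1, h.2, consExp_zero_zero]⟩

theorem consExp_add (a b : ℕ) (α β : ℕ →₀ ℕ) :
    consExp (a + b) (α + β) = consExp a α + consExp b β := by
  simp only [consExp, Finsupp.single_add, Finsupp.mapDomain_add]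
  abel

/-- The coefficient of `x^β` in `f(X, x 0, x 1, …)`, as a polynomial in `X`. -/
def slice (f : MvPowerSeries ℕ K) (β : ℕ →₀ ℕ) : Polynomial K :=
  ∑ᶠ b, Polynomial.monomial b (MvPowerSeries.coeff (consExp b β) f)

/-- `N` bounds the degrees of the monomials of `f`. -/
def IsDegreeBound (N : ℕ) (f : MvPowerSeries ℕ K) : Prop :=
  ∀ α : ℕ →₀ ℕ, MvPowerSeries.coeff α f ≠ 0 → α.degree ≤ N

theorem IsDegreeBound.mono {M N : ℕ} {f : MvPowerSeries ℕ K} (h : IsDegreeBound M f)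
    (hMN : M ≤ N) : IsDegreeBound N f := fun α hα => (h α hα).trans hMN

theorem slice_eq_sum {N : ℕ} {f : MvPowerSeries ℕ K} (hN : IsDegreeBound N f) (β : ℕ →₀ ℕ) :
    slice f β = ∑ b ∈ Finset.range (N + 1),
      Polynomial.monomial b (MvPowerSeries.coeff (consExp b β) f) := by
  refine finsum_eq_sum_of_support_subset _ fun b hb => ?_
  rw [Function.mem_support, Ne, Polynomial.monomial_eq_zero_iff] at hb
  have := hN _ hb
  rw [degree_consExp] at this
  simp only [Finset.coe_range, Set.mem_Iio]
  omega

theorem coeff_slice {f : MvPowerSeries ℕ K} (hf : f ∈ BoundedSeries K) (β : ℕ →₀ ℕ) (b : ℕ) :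
    (slice f β).coeff b = MvPowerSeries.coeff (consExp b β) f := by
  obtain ⟨N, hN⟩ := hf
  rw [slice_eq_sum hN, Polynomial.finsetSum_coeff]
  simp only [Polynomial.coeff_monomial]
  rw [Finset.sum_ite_eq' (Finset.range (N + 1)) b]
  split_ifs with h
  · rfl
  · by_contra h'
    have := hN _ (Ne.symm h')
    rw [degree_consExp] at this
    rw [Finset.mem_range] at h
    omega

/-- A splitting of the exponent vector (b, β) is a splitting of b together with a splitting of β, so
the coefficient sums on both sides have the same terms. -/
theorem slice_mul {f g : MvPowerSeries ℕ K} (hf : f ∈ BoundedSeries K) (hg : g ∈ BoundedSeries K)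
    (β : ℕ →₀ ℕ) :
    slice (f * g) β = ∑ p ∈ Finset.HasAntidiagonal.antidiagonal β, slice f p.1 * slice g p.2 := by
  classical
  ext b
  rw [coeff_slice (mul_mem hf hg), MvPowerSeries.coeff_mul, Polynomial.finsetSum_coeff]
  simp only [Polynomial.coeff_mul, coeff_slice hf, coeff_slice hg]
  rw [← Finset.sum_product']
  symm
  refine Finset.sum_bij (fun p _ => (consExp p.2.1 p.1.1, consExp p.2.2 p.1.2)) ?_ ?_ ?_ ?_
  · rintro ⟨⟨α, α'⟩, a, a'⟩ h
    simp only [Finset.mem_product, Finset.HasAntidiagonal.mem_antidiagonal] at h ⊢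
    rw [← consExp_add, h.1, h.2]
  · rintro ⟨⟨α, α'⟩, a, a'⟩ - ⟨⟨α₁, α₁'⟩, a₁, a₁'⟩ - h
    simp only [Prod.mk.injEq, consExp_inj] at h ⊢
    tauto
  · rintro ⟨α, α'⟩ h
    obtain ⟨a, γ, rfl⟩ := exists_eq_consExp α
    obtain ⟨a', γ', rfl⟩ := exists_eq_consExp α'
    rw [Finset.HasAntidiagonal.mem_antidiagonal, ← consExp_add, consExp_inj] at h
    exact ⟨((γ, γ'), (a, a')), by simpa [Finset.mem_product, and_comm] using h, rfl⟩
  · intros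
    rfl

/-- The series `f(s, x 0, x 1, …)`. -/
def specializeSeries (s : K) (f : MvPowerSeries ℕ K) : MvPowerSeries ℕ K :=
  fun β => (slice f β).eval s

theorem specializeSeries_mem (s : K) {f : MvPowerSeries ℕ K} (hf : f ∈ SymFun K) :
    specializeSeries s f ∈ SymFun K := by
  have hb : f ∈ BoundedSeries K := hf.2
  refine ⟨?_, ?_⟩
  · rw [SetLike.mem_coe, mem_symSeries_iff]
    intro σ β
    change (slice f (β.mapDomain σ)).eval s = (slice f β).eval s
    congr 1
    ext b
    rw [coeff_slice hb, coeff_slice hb, consExp, consExp, ← Finsupp.mapDomain_comp]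
    exact coeff_single_add_mapDomain_eq hf.1 b β (Nat.succ_injective.comp σ.injective)
      Nat.succ_injective (fun i => Nat.succ_ne_zero _) (fun i => Nat.succ_ne_zero _)
  · obtain ⟨N, hN⟩ := hf.2
    refine ⟨N, fun β h => ?_⟩
    by_contra hlt
    apply h
    change (slice f β).eval s = 0
    rw [show slice f β = 0 from ?_, Polynomial.eval_zero]
    ext b
    rw [coeff_slice hb, Polynomial.coeff_zero]
    by_contra h'
    have := hN _ h'
    rw [degree_consExp] at this
    omega

/-- The algebra homomorphism `f ↦ f(s, x 0, x 1, …)`. -/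
def specialize (s : K) : SymFun K →ₐ[K] SymFun K :=
  AlgHom.ofLinearMap
    { toFun := fun f => ⟨specializeSeries s f, specializeSeries_mem s f.2⟩
      map_add' := by
        intro f g
        refine Subtype.ext (funext fun β => ?_)
        change (slice (f.1 + g.1) β).eval s =
          (slice f.1 β).eval s + (slice g.1 β).eval s
        rw [← Polynomial.eval_add]
        congr 1
        ext b
        rw [Polynomial.coeff_add, coeff_slice (add_mem f.2.2 g.2.2), coeff_slice f.2.2,
          coeff_slice g.2.2, map_add]
      map_smul' := by
        intro c f
        refine Subtype.ext (funext fun β => ?_)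
        change (slice (c • (f : MvPowerSeries ℕ K)) β).eval s =
          c * (slice (f : MvPowerSeries ℕ K) β).eval s
        rw [← smul_eq_mul, ← Polynomial.eval_smul]
        congr 1
        ext b
        rw [Polynomial.coeff_smul, coeff_slice (Subalgebra.smul_mem _ f.2.2 c), coeff_slice f.2.2,
          MvPowerSeries.coeff_smul, smul_eq_mul] }
    (by
      classical
      refine Subtype.ext (funext fun β => ?_)
      change (slice (1 : MvPowerSeries ℕ K) β).eval s =
        MvPowerSeries.coeff β (1 : MvPowerSeries ℕ K)
      have h : slice (1 : MvPowerSeries ℕ K) β = Polynomial.C (MvPowerSeries.coeff β 1) := by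
        ext b
        simp only [coeff_slice (one_mem _), MvPowerSeries.coeff_one, Polynomial.coeff_C,
          consExp_eq_zero, ite_and]
      rw [h, Polynomial.eval_C])
    (by
      classical
      intro f g
      refine Subtype.ext (funext fun β => ?_)
      change (slice (f.1 * g.1) β).eval s =
        MvPowerSeries.coeff β (specializeSeries s f.1 * specializeSeries s g.1)
      rw [slice_mul f.2.2 g.2.2, MvPowerSeries.coeff_mul, Polynomial.eval_finsetSum]
      exact Finset.sum_congr rfl fun p _ => Polynomial.eval_mul)

theorem coeff_specialize (s : K) {N : ℕ} {f : SymFun K}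
    (hN : IsDegreeBound N (f : MvPowerSeries ℕ K)) (β : ℕ →₀ ℕ) :
    MvPowerSeries.coeff β (specialize s f : MvPowerSeries ℕ K) = ∑ b ∈ Finset.range (N + 1),
      s ^ b * MvPowerSeries.coeff (consExp b β) (f : MvPowerSeries ℕ K) := by
  change (slice (f : MvPowerSeries ℕ K) β).eval s = _
  rw [slice_eq_sum hN, Polynomial.eval_finsetSum]
  exact Finset.sum_congr rfl fun b _ => by rw [Polynomial.eval_monomial, mul_comm]

/-! ### Specialization and the comultiplication -/

/-- The coefficient of `y^β` in `f(x, y)`, as a symmetric function of `x`. -/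
def symCoeff (f : SymFun K) (β : ℕ →₀ ℕ) : SymFun K :=
  ⟨yCoeff (f : MvPowerSeries ℕ K) β, yCoeff_mem f β⟩

theorem coeff_symCoeff (f : SymFun K) (α β : ℕ →₀ ℕ) :
    MvPowerSeries.coeff α (symCoeff f β : MvPowerSeries ℕ K) = MvPowerSeries.coeff
      ((Finsupp.sumElim α β).mapDomain Equiv.natSumNatEquivNat) (f : MvPowerSeries ℕ K) :=
  coeff_yCoeff _ α β

theorem coeff_perp (F : SymSeries K) (f : SymFun K) (β : ℕ →₀ ℕ) :
    MvPowerSeries.coeff β (perp F f : MvPowerSeries ℕ K) = hall F (symCoeff f β) := rfl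

theorem isDegreeBound_symCoeff {N : ℕ} {f : SymFun K}
    (hN : IsDegreeBound N (f : MvPowerSeries ℕ K)) (β : ℕ →₀ ℕ) :
    IsDegreeBound N (symCoeff f β : MvPowerSeries ℕ K) := by
  intro α h
  rw [coeff_symCoeff] at h
  have := hN _ h
  rw [degree_sumElim] at this
  omega

theorem mapDomain_sumElim {ι : Type*} (w : ℕ ⊕ ℕ → ι) (α β : ℕ →₀ ℕ) :
    (Finsupp.sumElim α β).mapDomain w = α.mapDomain (w ∘ Sum.inl) + β.mapDomain (w ∘ Sum.inr) := by
  rw [Finsupp.sumElim_eq_add, Finsupp.mapDomain_add, ← Finsupp.mapDomain_comp,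
    ← Finsupp.mapDomain_comp]

/-- In a symmetric function the variable carrying the exponent b may be any one distinct from the
others; here it joins the alphabet y. In `coeff_consExp_symCoeff` it joins the alphabet x. -/
theorem coeff_consExp_sumElim (f : SymFun K) (b : ℕ) (α β : ℕ →₀ ℕ) :
    MvPowerSeries.coeff (consExp b ((Finsupp.sumElim α β).mapDomain Equiv.natSumNatEquivNat))
        (f : MvPowerSeries ℕ K) =
      MvPowerSeries.coeff α (symCoeff f (consExp b β) : MvPowerSeries ℕ K) := by
  have e : (Finsupp.sumElim α (consExp b β)).mapDomain Equiv.natSumNatEquivNat =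
      Finsupp.single (Equiv.natSumNatEquivNat (Sum.inr 0)) b + (Finsupp.sumElim α β).mapDomain
        (Equiv.natSumNatEquivNat ∘ Sum.map id Nat.succ) := by
    rw [mapDomain_sumElim, mapDomain_sumElim, consExp, Finsupp.mapDomain_add,
      Finsupp.mapDomain_single, ← Finsupp.mapDomain_comp, add_left_comm]
    rfl
  rw [coeff_symCoeff, e, consExp, ← Finsupp.mapDomain_comp]
  refine coeff_single_add_mapDomain_eq f.2.1 b _
    (Nat.succ_injective.comp Equiv.natSumNatEquivNat.injective)
    (Equiv.natSumNatEquivNat.injective.comp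
      (Sum.map_injective.2 ⟨Function.injective_id, Nat.succ_injective⟩))
    (fun i => Nat.succ_ne_zero _) (fun i h => ?_)
  have := Equiv.natSumNatEquivNat.injective h
  rcases i with i | i <;> simp at this

theorem coeff_consExp_symCoeff (f : SymFun K) (b : ℕ) (α β : ℕ →₀ ℕ) :
    MvPowerSeries.coeff (consExp b α) (symCoeff f β : MvPowerSeries ℕ K) =
      MvPowerSeries.coeff (consExp b ((Finsupp.sumElim α β).mapDomain Equiv.natSumNatEquivNat))
        (f : MvPowerSeries ℕ K) := by
  have e : (Finsupp.sumElim (consExp b α) β).mapDomain Equiv.natSumNatEquivNat =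
      Finsupp.single (Equiv.natSumNatEquivNat (Sum.inl 0)) b + (Finsupp.sumElim α β).mapDomain
        (Equiv.natSumNatEquivNat ∘ Sum.map Nat.succ id) := by
    rw [mapDomain_sumElim, mapDomain_sumElim, consExp, Finsupp.mapDomain_add,
      Finsupp.mapDomain_single, ← Finsupp.mapDomain_comp, add_assoc]
    rfl
  rw [coeff_symCoeff, e, consExp, ← Finsupp.mapDomain_comp]
  refine coeff_single_add_mapDomain_eq f.2.1 b _
    (Equiv.natSumNatEquivNat.injective.comp
      (Sum.map_injective.2 ⟨Nat.succ_injective, Function.injective_id⟩))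
    (Nat.succ_injective.comp Equiv.natSumNatEquivNat.injective)
    (fun i h => ?_) (fun i => Nat.succ_ne_zero _)
  have := Equiv.natSumNatEquivNat.injective h
  rcases i with i | i <;> simp at this

theorem coeff_zero_symCoeff (f : SymFun K) (β : ℕ →₀ ℕ) :
    MvPowerSeries.coeff 0 (symCoeff f β : MvPowerSeries ℕ K) =
      MvPowerSeries.coeff β (f : MvPowerSeries ℕ K) := by
  rw [coeff_symCoeff, mapDomain_sumElim, Finsupp.mapDomain_zero, zero_add]
  conv_rhs => rw [← Finsupp.mapDomain_id (v := β)]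
  exact coeff_mapDomain_eq f.2.1 β (Equiv.natSumNatEquivNat.injective.comp Sum.inr_injective)
    Function.injective_id

/-- The specialized variable is taken from the alphabet x. Taking it from y gives
`symCoeff_specialize_eq_sum`; the two descriptions are what relates E(t)^⊥ to specialization on both
sides. -/
theorem symCoeff_specialize (s : K) (f : SymFun K) (β : ℕ →₀ ℕ) :
    symCoeff (specialize s f) β = specialize s (symCoeff f β) := by
  obtain ⟨N, hN⟩ := f.2.2
  ext α
  rw [coeff_symCoeff, coeff_specialize s hN, coeff_specialize s (isDegreeBound_symCoeff hN β)]
  exact Finset.sum_congr rfl fun b _ => by rw [coeff_consExp_symCoeff]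

theorem symCoeff_specialize_eq_sum (s : K) {N : ℕ} {f : SymFun K}
    (hN : IsDegreeBound N (f : MvPowerSeries ℕ K)) (β : ℕ →₀ ℕ) :
    symCoeff (specialize s f) β =
      ∑ b ∈ Finset.range (N + 1), s ^ b • symCoeff f (consExp b β) := by
  ext α
  rw [coeff_symCoeff, coeff_specialize s hN, AddSubmonoidClass.coe_finsetSum, map_sum]
  refine Finset.sum_congr rfl fun b _ => ?_
  rw [coeff_consExp_sumElim]
  rfl

end Specialize

/-! ### Schur functions as leading terms of dual stable Grothendieck polynomials -/

section Schur

variable {K : Type*} [CommRing K]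

theorem skewCells_bot (lam : YoungDiagram) : skewCells lam ⊥ = lam.cells := by
  rw [skewCells, YoungDiagram.cells_bot, Finset.sdiff_empty]

theorem skewSize_bot (lam : YoungDiagram) : skewSize lam ⊥ = lam.card := by
  rw [skewSize, skewCells_bot]

theorem skewSize_add_card {lam mu : YoungDiagram} (h : mu ≤ lam) :
    skewSize lam mu + mu.card = lam.card :=
  Finset.card_sdiff_add_card_eq_card (YoungDiagram.cells_subset_iff.2 h)

theorem numColumns_le_skewSize (lam mu : YoungDiagram) : numColumns lam mu ≤ skewSize lam mu :=
  Finset.card_image_le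

theorem degree_tableauWeight {lam : YoungDiagram} (T : SemistandardYoungTableau lam) :
    (tableauWeight T).degree = lam.card := by
  rw [tableauWeight, map_sum]
  simp [YoungDiagram.card]

theorem injOn_entry_prod {lam : YoungDiagram}
    (T : SemistandardYoungTableau lam) :
    Set.InjOn (fun c : ℕ × ℕ => (T c.1 c.2, c.2)) lam.cells := by
  rintro ⟨i, j⟩ h ⟨i', j'⟩ h' he
  simp only [Prod.mk.injEq, Finset.mem_coe, YoungDiagram.mem_cells] at he h h'
  obtain ⟨he, rfl⟩ := he
  rcases lt_trichotomy i i' with hi | rfl | hi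
  · exact absurd he (T.col_strict hi h').ne
  · rfl
  · exact absurd he (T.col_strict hi h).ne'

/-- A semistandard tableau is a reverse plane partition. -/
def toReversePlanePartition {lam : YoungDiagram} (T : SemistandardYoungTableau lam) :
    ReversePlanePartition lam ⊥ where
  entry i j := T i j
  row_weak hj _ h := T.row_weak hj (by rwa [skewCells_bot] at h)
  col_weak hi _ h := (T.col_strict hi (by rwa [skewCells_bot] at h)).le
  zeros h := T.zeros (by rwa [skewCells_bot] at h)

theorem weight_toReversePlanePartition {lam : YoungDiagram} (T : SemistandardYoungTableau lam) :
    (toReversePlanePartition T).weight = tableauWeight T := by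
  rw [ReversePlanePartition.weight, skewCells_bot, tableauWeight]
  exact Finset.sum_image (injOn_entry_prod T)

/-- The degree of the weight counts the distinct pairs (entry, column). If it equals the number of
boxes, no column repeats an entry, so columns increase strictly. -/
theorem exists_toReversePlanePartition {lam : YoungDiagram} (T : ReversePlanePartition lam ⊥)
    (h : T.weight.degree = lam.card) :
    ∃ T' : SemistandardYoungTableau lam, toReversePlanePartition T' = T := by
  rw [ReversePlanePartition.degree_weight, skewCells_bot, YoungDiagram.card,
    Finset.card_image_iff] at h
  refine ⟨⟨fun i j => T.entry i j, ?_, ?_, ?_⟩, rfl⟩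
  · intro i j1 j2 hj hc
    refine T.row_weak hj ?_ (by rwa [skewCells_bot])
    rw [skewCells_bot]
    exact lam.up_left_mem le_rfl hj.le hc
  · intro i1 i2 j hi hc
    have hc' : (i1, j) ∈ lam := lam.up_left_mem hi.le le_rfl hc
    refine lt_of_le_of_ne (T.col_weak hi (by rwa [skewCells_bot]) (by rwa [skewCells_bot])) ?_
    intro he
    have := h (x₁ := (i1, j)) hc' (x₂ := (i2, j)) hc (by simp [he])
    simp only [Prod.mk.injEq, and_true] at this
    omega
  · intro i j hc
    exact T.zeros (by rwa [skewCells_bot])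

theorem coeff_schur (lam : YoungDiagram) (α : ℕ →₀ ℕ) :
    MvPowerSeries.coeff α (schur K lam) =
      (Nat.card {T : SemistandardYoungTableau lam // tableauWeight T = α} : K) := rfl

theorem coeff_schur_eq_coeff_dualG {lam : YoungDiagram} {α : ℕ →₀ ℕ} (h : α.degree = lam.card) :
    MvPowerSeries.coeff α (schur K lam) = MvPowerSeries.coeff α (dualG K lam ⊥) := by
  rw [coeff_schur, coeff_dualG]
  congr 1
  refine Nat.card_congr (Equiv.ofBijective
    (fun T => ⟨toReversePlanePartition T.1, (weight_toReversePlanePartition T.1).trans T.2⟩)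
    ⟨?_, ?_⟩)
  · rintro ⟨T, hT⟩ ⟨T', hT'⟩ he
    refine Subtype.ext (SemistandardYoungTableau.ext fun i j => ?_)
    exact congrArg (fun S : {S : ReversePlanePartition lam ⊥ // S.weight = α} => S.1.entry i j) he
  · rintro ⟨T, rfl⟩
    obtain ⟨T', rfl⟩ := exists_toReversePlanePartition T h
    exact ⟨⟨T', (weight_toReversePlanePartition T').symm⟩, rfl⟩

theorem exists_tableau_of_coeff_schur_ne_zero {lam : YoungDiagram} {α : ℕ →₀ ℕ}
    (h : MvPowerSeries.coeff α (schur K lam) ≠ 0) :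
    ∃ T : SemistandardYoungTableau lam, tableauWeight T = α := by
  by_contra hne
  have : IsEmpty {T : SemistandardYoungTableau lam // tableauWeight T = α} :=
    ⟨fun T => hne ⟨T.1, T.2⟩⟩
  exact h (by rw [coeff_schur]; simp)

theorem degree_eq_of_coeff_schur_ne_zero {lam : YoungDiagram} {α : ℕ →₀ ℕ}
    (h : MvPowerSeries.coeff α (schur K lam) ≠ 0) : α.degree = lam.card := by
  obtain ⟨T, rfl⟩ := exists_tableau_of_coeff_schur_ne_zero h
  exact degree_tableauWeight T

/-- The Schur function is the top-degree part of g_λ. It inherits symmetry, and later the branching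
rule, from the incidence algebra. -/
theorem coeff_schur_eq_ite (lam : YoungDiagram) (α : ℕ →₀ ℕ) :
    MvPowerSeries.coeff α (schur K lam) =
      if α.degree = lam.card then dualGCoeff K α ⊥ lam else 0 := by
  split_ifs with h
  · rw [coeff_schur_eq_coeff_dualG h, dualGCoeff_apply _ bot_le]
  · by_contra hne
    exact h (degree_eq_of_coeff_schur_ne_zero hne)

theorem isDegreeBound_schur (lam : YoungDiagram) : IsDegreeBound lam.card (schur K lam) :=
  fun _ hα => (degree_eq_of_coeff_schur_ne_zero hα).le

theorem schur_mem (lam : YoungDiagram) : schur K lam ∈ SymFun K := by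
  refine ⟨?_, lam.card, isDegreeBound_schur lam⟩
  rw [SetLike.mem_coe, mem_symSeries_iff]
  intro σ α
  rw [coeff_schur_eq_ite, coeff_schur_eq_ite, dualGCoeff_mapDomain, Finsupp.degree_mapDomain]

/-- The Schur function as an element of `Λ`. -/
def schurSym (K : Type*) [CommRing K] (lam : YoungDiagram) : SymFun K := ⟨schur K lam, schur_mem lam⟩

/-! ### Kostka numbers -/

/-- The exponent vector `(λ 0, λ 1, …)` of a partition. -/
def rowContent (lam : YoungDiagram) : ℕ →₀ ℕ :=
  tableauWeight (SemistandardYoungTableau.highestWeight lam)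

theorem tableauWeight_apply {lam : YoungDiagram} (T : SemistandardYoungTableau lam) (k : ℕ) :
    tableauWeight T k = (lam.cells.filter fun c => T c.1 c.2 = k).card := by
  rw [tableauWeight, Finsupp.finsetSum_apply, Finset.card_filter]
  exact Finset.sum_congr rfl fun c _ => Finsupp.single_apply

theorem rowContent_apply (lam : YoungDiagram) (k : ℕ) : rowContent lam k = lam.rowLen k := by
  rw [rowContent, tableauWeight_apply, YoungDiagram.rowLen_eq_card, YoungDiagram.row]
  congr 1
  refine Finset.filter_congr fun c hc => ?_
  rw [SemistandardYoungTableau.highestWeight_apply, if_pos (by simpa using hc)]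

theorem rowContent_injective : Function.Injective rowContent := by
  intro lam mu h
  ext ⟨i, j⟩
  rw [YoungDiagram.mem_cells, YoungDiagram.mem_cells, YoungDiagram.mem_iff_lt_rowLen,
    YoungDiagram.mem_iff_lt_rowLen, ← rowContent_apply, ← rowContent_apply, h]

theorem degree_rowContent (lam : YoungDiagram) : (rowContent lam).degree = lam.card :=
  degree_tableauWeight _

/-- The sum of the row indices of the boxes, usually denoted `n(λ)`. -/
def rowIndexSum (lam : YoungDiagram) : ℕ := ∑ c ∈ lam.cells, c.1

theorem linearCombination_tableauWeight {lam : YoungDiagram} (T : SemistandardYoungTableau lam) :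
    Finsupp.linearCombination ℕ (id : ℕ → ℕ) (tableauWeight T) = ∑ c ∈ lam.cells, T c.1 c.2 := by
  rw [tableauWeight, map_sum]
  simp

theorem linearCombination_rowContent (lam : YoungDiagram) :
    Finsupp.linearCombination ℕ (id : ℕ → ℕ) (rowContent lam) = rowIndexSum lam := by
  rw [rowContent, linearCombination_tableauWeight]
  refine Finset.sum_congr rfl fun c hc => ?_
  rw [SemistandardYoungTableau.highestWeight_apply, if_pos (by simpa using hc)]

theorem row_le_entry {lam : YoungDiagram} (T : SemistandardYoungTableau lam) (i j : ℕ)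
    (h : (i, j) ∈ lam) : i ≤ T i j := by
  induction i with
  | zero => exact Nat.zero_le _
  | succ i ih =>
    exact Nat.succ_le_of_lt ((ih (lam.up_left_mem (Nat.le_succ i) le_rfl h)).trans_lt
      (T.col_strict (Nat.lt_succ_self i) h))

theorem rowIndexSum_le {lam mu : YoungDiagram} (T : SemistandardYoungTableau lam)
    (h : tableauWeight T = rowContent mu) : rowIndexSum lam ≤ rowIndexSum mu := by
  rw [← linearCombination_rowContent mu, ← h, linearCombination_tableauWeight]
  exact Finset.sum_le_sum fun c hc => row_le_entry T c.1 c.2 hc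

/-- In a semistandard tableau the entry in row i is at least i. Summing over all boxes compares n(λ)
with n(μ), and equality of the sums forces every entry to equal its row index. -/
theorem eq_highestWeight {lam mu : YoungDiagram} (T : SemistandardYoungTableau lam)
    (h : tableauWeight T = rowContent mu) (hle : rowIndexSum mu ≤ rowIndexSum lam) :
    T = SemistandardYoungTableau.highestWeight lam := by
  have hsum : ∑ c ∈ lam.cells, c.1 = ∑ c ∈ lam.cells, T c.1 c.2 := by
    rw [← linearCombination_tableauWeight, h, linearCombination_rowContent]
    exact le_antisymm (rowIndexSum_le T h) hle
  have heq := (Finset.sum_eq_sum_iff_of_le fun c hc => row_le_entry T c.1 c.2 hc).1 hsum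
  ext i j
  rw [SemistandardYoungTableau.highestWeight_apply]
  split_ifs with hc
  · exact (heq (i, j) hc).symm
  · exact T.zeros hc

theorem coeff_rowContent_schur_self (lam : YoungDiagram) :
    MvPowerSeries.coeff (rowContent lam) (schur K lam) = 1 := by
  rw [coeff_schur, Nat.card_eq_one_iff_unique.2, Nat.cast_one]
  refine ⟨⟨fun T T' => Subtype.ext ?_⟩,
    ⟨SemistandardYoungTableau.highestWeight lam, rfl⟩⟩
  rw [eq_highestWeight T.1 T.2 le_rfl, eq_highestWeight T'.1 T'.2 le_rfl]

/-- With `coeff_rowContent_schur_self` this says that the Kostka matrix is unitriangular with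
respect to n(λ). -/
theorem coeff_rowContent_schur_eq_zero {lam mu : YoungDiagram} (hne : lam ≠ mu)
    (hle : rowIndexSum mu ≤ rowIndexSum lam) :
    MvPowerSeries.coeff (rowContent mu) (schur K lam) = 0 := by
  by_contra h
  obtain ⟨T, hT⟩ := exists_tableau_of_coeff_schur_ne_zero h
  have := eq_highestWeight T hT hle
  subst this
  exact hne (rowContent_injective hT)

/-! ### Symmetric series are determined by their coefficients at partitions -/

theorem exists_coeff_eq_coeff_rowContent (α : ℕ →₀ ℕ) :
    ∃ mu : YoungDiagram, ∀ f ∈ SymSeries K,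
      MvPowerSeries.coeff α f = MvPowerSeries.coeff (rowContent mu) f := by
  obtain ⟨n, hn⟩ : ∃ n, ∀ k, n ≤ k → α k = 0 := by
    refine ⟨α.support.sup id + 1, fun k hk => ?_⟩
    by_contra h
    have := Finset.le_sup (f := id) (Finsupp.mem_support_iff.2 h)
    simp only [id] at this
    omega
  set γ : Fin n →₀ ℕ := α.comapDomain Fin.val Fin.val_injective.injOn with hγ
  have hα : α = γ.mapDomain Fin.val := by
    rw [hγ, Finsupp.mapDomain_comapDomain _ Fin.val_injective]
    intro k hk
    rw [Finset.mem_coe, Finsupp.mem_support_iff] at hk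
    exact ⟨⟨k, by by_contra h; exact hk (hn k (not_lt.1 h))⟩, rfl⟩
  -- Sorting in the order dual arranges the exponents in decreasing order.
  set τ : Equiv.Perm (Fin n) := Tuple.sort fun i => OrderDual.toDual (γ i) with hτ
  have hmono : ∀ i j, i ≤ j → γ (τ j) ≤ γ (τ i) := fun i j h =>
    OrderDual.toDual_le_toDual.1 (Tuple.monotone_sort (fun i => OrderDual.toDual (γ i)) h)
  set β : ℕ →₀ ℕ := γ.mapDomain fun i => ((τ.symm i : Fin n) : ℕ) with hβ
  have hinj : Function.Injective fun i : Fin n => ((τ.symm i : Fin n) : ℕ) :=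
    Fin.val_injective.comp τ.symm.injective
  have hβ1 : ∀ k (hk : k < n), β k = γ (τ ⟨k, hk⟩) := by
    intro k hk
    have := Finsupp.mapDomain_apply hinj γ (τ ⟨k, hk⟩)
    simpa using this
  have hβ2 : ∀ k, n ≤ k → β k = 0 := by
    intro k hk
    refine Finsupp.mapDomain_of_notMem_range _ _ ?_
    rintro ⟨i, hi⟩
    have := (τ.symm i).2
    simp only at hi
    omega
  have hanti : Antitone β := by
    intro i j hij
    by_cases hj : j < n
    · rw [hβ1 j hj, hβ1 i (hij.trans_lt hj)]
      exact hmono _ _ hij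
    · rw [hβ2 j (not_lt.1 hj)]
      exact Nat.zero_le _
  -- `ofColLens` prescribes columns, while the exponents are to be row lengths; hence the transpose.
  refine ⟨(ofColLens β hanti n (hβ2 n le_rfl)).transpose, fun f hf => ?_⟩
  have hc : rowContent (ofColLens β hanti n (hβ2 n le_rfl)).transpose = β := by
    ext k
    rw [rowContent_apply, YoungDiagram.rowLen_transpose, colLen_ofColLens]
  rw [hc, hα, hβ]
  exact coeff_mapDomain_eq hf γ Fin.val_injective hinj

theorem eq_of_coeff_rowContent {f g : MvPowerSeries ℕ K} (hf : f ∈ SymSeries K)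
    (hg : g ∈ SymSeries K) (h : ∀ mu, MvPowerSeries.coeff (rowContent mu) f =
      MvPowerSeries.coeff (rowContent mu) g) : f = g := by
  ext α
  obtain ⟨mu, hmu⟩ := exists_coeff_eq_coeff_rowContent (K := K) α
  rw [hmu f hf, hmu g hg, h]

/-! ### Schur expansions -/

theorem finite_card_le (n : ℕ) : {lam : YoungDiagram | lam.card ≤ n}.Finite := by
  refine Set.Finite.of_finite_image (f := YoungDiagram.cells) ?_
    (fun a _ b _ h => YoungDiagram.ext h)
  refine (Finset.finite_toSet (Finset.range n ×ˢ Finset.range n).powerset).subset ?_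
  rintro _ ⟨lam, hlam, rfl⟩
  rw [Finset.mem_coe, Finset.mem_powerset]
  rintro ⟨i, j⟩ hc
  rw [Set.mem_ofPred_eq] at hlam
  have h1 := YoungDiagram.mem_iff_lt_colLen.1 hc
  have h2 := YoungDiagram.mem_iff_lt_rowLen.1 hc
  have h3 : lam.colLen j ≤ lam.card := by
    rw [YoungDiagram.colLen_eq_card]
    exact Finset.card_le_card (Finset.filter_subset _ _)
  have h4 : lam.rowLen i ≤ lam.card := by
    rw [YoungDiagram.rowLen_eq_card]
    exact Finset.card_le_card (Finset.filter_subset _ _)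
  rw [Finset.mem_product, Finset.mem_range, Finset.mem_range]
  exact ⟨by omega, by omega⟩

/-- The Young diagrams with at most `n` boxes. -/
def diagramsLE (n : ℕ) : Finset YoungDiagram := (finite_card_le n).toFinset

theorem mem_diagramsLE {n : ℕ} {lam : YoungDiagram} : lam ∈ diagramsLE n ↔ lam.card ≤ n := by
  rw [diagramsLE, Set.Finite.mem_toFinset, Set.mem_ofPred_eq]

theorem finsum_schur_eq_sum (A : YoungDiagram → K) {α : ℕ →₀ ℕ} {n : ℕ} (hn : α.degree ≤ n) :
    ∑ᶠ lam, A lam * MvPowerSeries.coeff α (schur K lam) =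
      ∑ lam ∈ diagramsLE n, A lam * MvPowerSeries.coeff α (schur K lam) := by
  refine finsum_eq_sum_of_support_subset _ fun lam h => ?_
  have := degree_eq_of_coeff_schur_ne_zero (right_ne_zero_of_mul h)
  rw [Finset.mem_coe, mem_diagramsLE]
  omega

/-- The series `∑_λ A_λ s_λ`. -/
def schurSeries (A : YoungDiagram → K) : MvPowerSeries ℕ K :=
  fun α => ∑ lam ∈ diagramsLE α.degree, A lam * MvPowerSeries.coeff α (schur K lam)

theorem coeff_schurSeries (A : YoungDiagram → K) (α : ℕ →₀ ℕ) :
    MvPowerSeries.coeff α (schurSeries A) =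
      ∑ lam ∈ diagramsLE α.degree, A lam * MvPowerSeries.coeff α (schur K lam) := rfl

theorem isSchurExpansion_iff {F : MvPowerSeries ℕ K} {A : YoungDiagram → K} :
    IsSchurExpansion F A ↔ F = schurSeries A := by
  rw [MvPowerSeries.ext_iff]
  exact forall_congr' fun α => by rw [finsum_schur_eq_sum A le_rfl, coeff_schurSeries]

theorem schurSeries_mem (A : YoungDiagram → K) : schurSeries A ∈ SymSeries K := by
  rw [mem_symSeries_iff]
  intro σ α
  rw [coeff_schurSeries, coeff_schurSeries, Finsupp.degree_mapDomain]
  exact Finset.sum_congr rfl fun lam _ => by rw [mem_symSeries_iff.1 (schur_mem lam).1]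

theorem coeff_rowContent_schurSeries (A : YoungDiagram → K) (mu : YoungDiagram) :
    MvPowerSeries.coeff (rowContent mu) (schurSeries A) =
      A mu + ∑ lam ∈ (diagramsLE mu.card).filter fun lam => rowIndexSum lam < rowIndexSum mu,
        A lam * MvPowerSeries.coeff (rowContent mu) (schur K lam) := by
  rw [coeff_schurSeries, degree_rowContent,
    ← Finset.add_sum_erase _ _ (mem_diagramsLE.2 (le_refl mu.card)), coeff_rowContent_schur_self,
    mul_one]
  congr 1
  symm
  refine Finset.sum_subset (fun lam h => ?_) (fun lam h h' => ?_)
  · rw [Finset.mem_filter] at h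
    exact Finset.mem_erase.2 ⟨fun he => (he ▸ h.2).ne rfl, h.1⟩
  · rw [Finset.mem_erase] at h
    rw [Finset.mem_filter, not_and, not_lt] at h'
    rw [coeff_rowContent_schur_eq_zero h.1 (h' h.2), mul_zero]

/-- The solution of the triangular system for the coefficients of a Schur expansion. -/
def triangularSolution (F : MvPowerSeries ℕ K) (mu : YoungDiagram) : K :=
  MvPowerSeries.coeff (rowContent mu) F -
    ∑ lam ∈ ((diagramsLE mu.card).filter fun lam => rowIndexSum lam < rowIndexSum mu).attach,
      triangularSolution F lam.1 * MvPowerSeries.coeff (rowContent mu) (schur K lam.1)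
termination_by rowIndexSum mu
decreasing_by exact (Finset.mem_filter.1 lam.2).2

theorem schurSeries_triangularSolution {F : MvPowerSeries ℕ K} (hF : F ∈ SymSeries K) :
    schurSeries (triangularSolution F) = F := by
  refine eq_of_coeff_rowContent (schurSeries_mem _) hF fun mu => ?_
  rw [coeff_rowContent_schurSeries, triangularSolution, Finset.sum_attach
    ((diagramsLE mu.card).filter fun lam => rowIndexSum lam < rowIndexSum mu)
    (fun lam => triangularSolution F lam * MvPowerSeries.coeff (rowContent mu) (schur K lam)),
    sub_add_cancel]

/-- Strong induction on n(μ): in `coeff_rowContent_schurSeries` all terms other than `A mu` involve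
shapes with smaller n. -/
theorem schurSeries_injective : Function.Injective (schurSeries (K := K)) := by
  intro A B h
  have key : ∀ n mu, rowIndexSum mu = n → A mu = B mu := by
    intro n
    induction n using Nat.strong_induction_on with
    | _ n ih =>
      intro mu hmu
      have h' := congrArg (MvPowerSeries.coeff (rowContent mu)) h
      rw [coeff_rowContent_schurSeries, coeff_rowContent_schurSeries, Finset.sum_congr rfl
        fun lam hlam => by rw [ih _ (hmu ▸ (Finset.mem_filter.1 hlam).2) lam rfl]] at h'
      exact add_right_cancel h'
  exact funext fun mu => key _ mu rfl

theorem schurCoeff_schurSeries (A : YoungDiagram → K) : schurCoeff (schurSeries A) = A := by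
  have h : ∃! B : YoungDiagram → K, IsSchurExpansion (schurSeries A) B :=
    ⟨A, isSchurExpansion_iff.2 rfl,
      fun B hB => schurSeries_injective (isSchurExpansion_iff.1 hB).symm⟩
  rw [schurCoeff, dif_pos h]
  exact schurSeries_injective (isSchurExpansion_iff.1 h.choose_spec.1).symm

theorem schurSeries_schurCoeff {F : MvPowerSeries ℕ K} (hF : F ∈ SymSeries K) :
    schurSeries (schurCoeff F) = F := by
  obtain ⟨A, rfl⟩ : ∃ A, F = schurSeries A := ⟨_, (schurSeries_triangularSolution hF).symm⟩
  rw [schurCoeff_schurSeries]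

/-! ### Linearity of Schur coefficients and of the Hall pairing. -/

theorem schurSeries_add (A B : YoungDiagram → K) :
    schurSeries (A + B) = schurSeries A + schurSeries B := by
  ext α
  rw [map_add, coeff_schurSeries, coeff_schurSeries, coeff_schurSeries, ← Finset.sum_add_distrib]
  exact Finset.sum_congr rfl fun lam _ => add_mul _ _ _

theorem schurSeries_smul (c : K) (A : YoungDiagram → K) :
    schurSeries (c • A) = c • schurSeries A := by
  ext α
  rw [MvPowerSeries.coeff_smul, coeff_schurSeries, coeff_schurSeries, Finset.mul_sum]
  exact Finset.sum_congr rfl fun lam _ => mul_assoc _ _ _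

theorem schurCoeff_add {F G : MvPowerSeries ℕ K} (hF : F ∈ SymSeries K) (hG : G ∈ SymSeries K) :
    schurCoeff (F + G) = schurCoeff F + schurCoeff G := by
  rw [← schurCoeff_schurSeries (schurCoeff F + schurCoeff G), schurSeries_add,
    schurSeries_schurCoeff hF, schurSeries_schurCoeff hG]

theorem schurCoeff_smul (c : K) {F : MvPowerSeries ℕ K} (hF : F ∈ SymSeries K) :
    schurCoeff (c • F) = c • schurCoeff F := by
  rw [← schurCoeff_schurSeries (c • schurCoeff F), schurSeries_smul, schurSeries_schurCoeff hF]

theorem schurCoeff_schur (lam : YoungDiagram) :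
    schurCoeff (schur K lam) = Pi.single lam 1 := by
  rw [← schurCoeff_schurSeries (Pi.single lam (1 : K))]
  congr 1
  ext α
  rw [coeff_schurSeries]
  simp only [Pi.single_apply, ite_mul, one_mul, zero_mul, Finset.sum_ite_eq', mem_diagramsLE]
  split_ifs with h
  · rfl
  · by_contra hne
    exact h (degree_eq_of_coeff_schur_ne_zero hne).ge

/-- Discarding the coefficients of shapes with more than N boxes does not change the series, since
Schur functions are homogeneous. Uniqueness of the expansion then makes the discarded coefficients
vanish. -/
theorem schurCoeff_eq_zero {N : ℕ} {F : MvPowerSeries ℕ K} (hF : F ∈ SymSeries K)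
    (hN : IsDegreeBound N F) {lam : YoungDiagram} (hlam : N < lam.card) :
    schurCoeff F lam = 0 := by
  have h : F = schurSeries fun lam => if lam.card ≤ N then schurCoeff F lam else 0 := by
    ext α
    conv_lhs => rw [← schurSeries_schurCoeff hF]
    rw [coeff_schurSeries, coeff_schurSeries]
    by_cases hα : α.degree ≤ N
    · refine Finset.sum_congr rfl fun mu hmu => ?_
      rw [mem_diagramsLE] at hmu
      rw [if_pos (hmu.trans hα)]
    · rw [← coeff_schurSeries, schurSeries_schurCoeff hF]
      rw [Finset.sum_eq_zero]
      · by_contra h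
        exact hα (hN α h)
      · intro mu _
        split_ifs with h
        · by_cases h0 : MvPowerSeries.coeff α (schur K mu) = 0
          · rw [h0, mul_zero]
          · exact absurd (degree_eq_of_coeff_schur_ne_zero h0) (by omega)
        · rw [zero_mul]
  rw [h, schurCoeff_schurSeries, if_neg (by omega)]

theorem eq_sum_schurSym {N : ℕ} {f : SymFun K} (hN : IsDegreeBound N (f : MvPowerSeries ℕ K)) :
    f = ∑ lam ∈ diagramsLE N, schurCoeff (f : MvPowerSeries ℕ K) lam • schurSym K lam := by
  ext α
  rw [AddSubmonoidClass.coe_finsetSum, map_sum]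
  by_cases hα : α.degree ≤ N
  · conv_lhs => rw [← schurSeries_schurCoeff f.2.1]
    rw [coeff_schurSeries, ← finsum_schur_eq_sum _ le_rfl, finsum_schur_eq_sum _ hα]
    rfl
  · rw [Finset.sum_eq_zero]
    · by_contra h
      exact hα (hN α h)
    · intro lam hlam
      rw [mem_diagramsLE] at hlam
      change _ * MvPowerSeries.coeff α (schur K lam) = 0
      by_cases h0 : MvPowerSeries.coeff α (schur K lam) = 0
      · rw [h0, mul_zero]
      · exact absurd (degree_eq_of_coeff_schur_ne_zero h0) (by omega)

theorem linearMap_ext_schurSym {M : Type*} [AddCommMonoid M] [Module K M]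
    {φ ψ : SymFun K →ₗ[K] M} (h : ∀ lam, φ (schurSym K lam) = ψ (schurSym K lam)) : φ = ψ := by
  ext f
  obtain ⟨N, hN⟩ := f.2.2
  rw [eq_sum_schurSym hN, map_sum, map_sum]
  exact Finset.sum_congr rfl fun lam _ => by rw [map_smul, map_smul, h]

theorem finite_support_hall (F : SymSeries K) (f : SymFun K) :
    (Function.support fun lam : YoungDiagram =>
      schurCoeff (F : MvPowerSeries ℕ K) lam * schurCoeff (f : MvPowerSeries ℕ K) lam).Finite := by
  obtain ⟨N, hN⟩ := f.2.2
  refine (finite_card_le N).subset fun lam hlam => ?_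
  by_contra h
  rw [Set.mem_ofPred_eq, not_le] at h
  exact hlam (by simp only [schurCoeff_eq_zero f.2.1 hN h, mul_zero])

/-- The Hall inner product with a fixed series, as a linear map. -/
def hallLinear (F : SymSeries K) : SymFun K →ₗ[K] K where
  toFun := hall F
  map_add' f g := by
    rw [hall, hall, hall, ← finsum_add_distrib (finite_support_hall F f) (finite_support_hall F g)]
    refine finsum_congr fun lam => ?_
    rw [← mul_add]
    congr 1
    exact congrFun (schurCoeff_add f.2.1 g.2.1) lam
  map_smul' c f := by
    rw [hall, hall, RingHom.id_apply, smul_finsum' c (finite_support_hall F f)]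
    refine finsum_congr fun lam => ?_
    rw [smul_eq_mul, mul_left_comm]
    congr 1
    exact congrFun (schurCoeff_smul c f.2.1) lam

theorem hallLinear_apply (F : SymSeries K) (f : SymFun K) : hallLinear F f = hall F f := rfl

theorem hall_schurSym (F : SymSeries K) (lam : YoungDiagram) :
    hall F (schurSym K lam) = schurCoeff (F : MvPowerSeries ℕ K) lam := by
  change ∑ᶠ mu, schurCoeff (F : MvPowerSeries ℕ K) mu * schurCoeff (schur K lam) mu = _
  rw [schurCoeff_schur, finsum_eq_single _ lam fun mu h => by rw [Pi.single_eq_of_ne h, mul_zero],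
    Pi.single_eq_same, mul_one]

end Schur

/-! ### One-column shapes -/

theorem colLen_column (k j : ℕ) : (column k).colLen j = if j = 0 then k else 0 := by
  have key : ∀ i, i < (column k).colLen j ↔ i < k ∧ j = 0 := by
    intro i
    rw [← YoungDiagram.mem_iff_lt_colLen, ← YoungDiagram.mem_cells]
    simp [column, eq_comm]
  split_ifs with h
  · have h1 := key k
    have h2 := key ((column k).colLen j)
    omega
  · by_contra hne
    exact h ((key 0).1 (Nat.pos_of_ne_zero hne)).2

theorem card_column (k : ℕ) : (column k).card = k := by
  simp [YoungDiagram.card, column]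

theorem column_injective : Function.Injective column := fun a b h => by
  rw [← card_column a, h, card_column]

theorem column_le_iff {k : ℕ} {lam : YoungDiagram} : column k ≤ lam ↔ k ≤ lam.colLen 0 := by
  rw [le_iff_colLen]
  constructor
  · intro h
    simpa [colLen_column] using h 0
  · intro h j
    rw [colLen_column]
    split_ifs with hj
    · rwa [hj]
    · exact Nat.zero_le _

theorem column_zero : column 0 = ⊥ := by
  ext c
  simp [column]

theorem colLen_bot (j : ℕ) : (⊥ : YoungDiagram).colLen j = 0 := by
  rw [← column_zero, colLen_column, ite_self]

theorem isVerticalStrip_column (k : ℕ) : IsVerticalStrip (column k) ⊥ := by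
  rw [isVerticalStrip_iff]
  intro j
  simp [colLen_column]

theorem eq_column_of_colLen_one {nu : YoungDiagram} (h : nu.colLen 1 = 0) :
    nu = column (nu.colLen 0) := by
  refine eq_of_colLen fun j => ?_
  rw [colLen_column]
  split_ifs with hj
  · rw [hj]
  · have := nu.colLen_anti 1 j (by omega)
    omega

theorem eq_column_of_isVerticalStrip {nu : YoungDiagram} (h : IsVerticalStrip nu ⊥) :
    nu = column (nu.colLen 0) := by
  refine eq_column_of_colLen_one ?_
  have := isVerticalStrip_iff.1 h 0
  rwa [colLen_bot, Nat.le_zero] at this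

theorem sum_isVerticalStrip_bot {M : Type*} [AddCommMonoid M] (lam : YoungDiagram)
    (F : YoungDiagram → M) :
    ∑ nu ∈ Finset.Icc ⊥ lam with IsVerticalStrip nu ⊥, F nu =
      ∑ k ∈ Finset.range (lam.colLen 0 + 1), F (column k) := by
  symm
  refine Finset.sum_bij (fun k _ => column k) ?_ ?_ ?_ ?_
  · intro k hk
    rw [Finset.mem_range] at hk
    rw [Finset.mem_filter, Finset.mem_Icc]
    exact ⟨⟨bot_le, column_le_iff.2 (by omega)⟩, isVerticalStrip_column k⟩
  · intro a _ b _ h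
    exact column_injective h
  · intro nu hnu
    rw [Finset.mem_filter, Finset.mem_Icc] at hnu
    have h := eq_column_of_isVerticalStrip hnu.2
    refine ⟨nu.colLen 0, ?_, h.symm⟩
    rw [Finset.mem_range, Nat.lt_succ_iff, ← column_le_iff, ← h]
    exact hnu.1.2
  · intros
    rfl

/-- Every nonempty column has at least one box, so equality means exactly one box in each; this is
the horizontal strip condition of the branching rule. -/
theorem numColumns_eq_skewSize_iff {lam mu : YoungDiagram} :
    numColumns lam mu = skewSize lam mu ↔ ∀ j, lam.colLen j ≤ mu.colLen j + 1 := by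
  have hn : lam.colLen (lam.rowLen 0) = 0 := colLen_eq_zero le_rfl
  rw [numColumns_eq_card mu hn, skewSize_eq_sum mu hn, Finset.card_filter,
    Finset.sum_eq_sum_iff_of_le (fun j _ => by split_ifs <;> omega)]
  constructor
  · intro h j
    by_cases hj : j < lam.rowLen 0
    · have := h j (Finset.mem_range.2 hj)
      split_ifs at this <;> omega
    · have := colLen_eq_zero (not_lt.1 hj)
      omega
  · intro h j _
    have := h j
    split_ifs <;> omega

section Pairing

variable {K : Type*} [CommRing K]

/-! ### The Schur expansion of `E(t)` -/

theorem elemSym_mem (i : ℕ) : elemSym K i ∈ SymSeries K :=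
  mem_symSeries_iff.2 fun σ α => coeff_elemSym_perm i σ α

theorem coeff_elemSym (i : ℕ) (α : ℕ →₀ ℕ) : MvPowerSeries.coeff α (elemSym K i) =
    if α.degree = i ∧ ∀ j ∈ α.support, α j = 1 then 1 else 0 := rfl

theorem eq_column_of_rowLen_le_one {mu : YoungDiagram} (h : ∀ k, mu.rowLen k ≤ 1) :
    mu = column mu.card := by
  have h1 : mu = column (mu.colLen 0) := by
    refine eq_column_of_colLen_one ?_
    by_contra hne
    have : (0, 1) ∈ mu := YoungDiagram.mem_iff_lt_colLen.2 (Nat.pos_of_ne_zero hne)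
    have := YoungDiagram.mem_iff_lt_rowLen.1 this
    have := h 0
    omega
  rw [h1, card_column]

theorem rowLen_column_le_one (k i : ℕ) : (column k).rowLen i ≤ 1 := by
  by_contra h
  have : (i, 1) ∈ column k := YoungDiagram.mem_iff_lt_rowLen.2 (not_le.1 h)
  have := YoungDiagram.mem_iff_lt_colLen.1 this
  simp [colLen_column] at this

theorem tableauWeight_column_le_one {i : ℕ} (T : SemistandardYoungTableau (column i)) (k : ℕ) :
    tableauWeight T k ≤ 1 := by
  rw [tableauWeight_apply, Finset.card_le_one]
  intro a ha b hb
  rw [Finset.mem_filter] at ha hb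
  have h0 : ∀ c ∈ (column i).cells, c.2 = 0 := by
    intro c hc
    simp only [column, Finset.mem_product, Finset.mem_singleton] at hc
    exact hc.2
  exact injOn_entry_prod T ha.1 hb.1
    (Prod.ext (ha.2.trans hb.2.symm) ((h0 a ha.1).trans (h0 b hb.1).symm))

/-- It suffices to compare coefficients at partitions. A tableau with a single column uses each
entry at most once, so on both sides only the content (1^i) survives, with coefficient 1. -/
theorem schur_column (i : ℕ) : schur K (column i) = elemSym K i := by
  refine eq_of_coeff_rowContent (schur_mem _).1 (elemSym_mem i) fun mu => ?_
  rw [coeff_elemSym, degree_rowContent]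
  by_cases hmu : mu = column i
  · subst hmu
    rw [coeff_rowContent_schur_self, if_pos]
    refine ⟨card_column i, fun j hj => ?_⟩
    rw [Finsupp.mem_support_iff] at hj
    rw [rowContent_apply] at *
    have := rowLen_column_le_one i j
    omega
  · rw [if_neg]
    · by_contra hne
      obtain ⟨T, hT⟩ := exists_tableau_of_coeff_schur_ne_zero hne
      have hcard : mu.card = i := by
        rw [← degree_rowContent, ← hT, degree_tableauWeight, card_column]
      refine hmu ?_
      rw [← hcard]
      refine eq_column_of_rowLen_le_one fun k => ?_
      rw [← rowContent_apply, ← hT]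
      exact tableauWeight_column_le_one T k
    · rintro ⟨rfl, h⟩
      refine hmu (eq_column_of_rowLen_le_one fun k => ?_)
      rw [← rowContent_apply]
      by_cases hk : k ∈ (rowContent mu).support
      · exact (h k hk).le
      · rw [Finsupp.notMem_support_iff.1 hk]
        exact Nat.zero_le _

theorem ESeries_eq_schurSeries (t : K) : ESeries t =
    schurSeries fun lam => if IsVerticalStrip lam ⊥ then t ^ lam.card else 0 := by
  ext α
  have h : MvPowerSeries.coeff α (ESeries t) =
      t ^ α.degree * MvPowerSeries.coeff α (elemSym K α.degree) := by
    refine Finset.sum_eq_single_of_mem _ (Finset.self_mem_range_succ _) fun i _ hi => ?_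
    rw [coeff_elemSym, if_neg fun h => hi h.1.symm, mul_zero]
  rw [h, coeff_schurSeries, Finset.sum_eq_single_of_mem (column α.degree)]
  · rw [if_pos (isVerticalStrip_column _), card_column, schur_column]
  · rw [mem_diagramsLE, card_column]
  · intro lam _ hne
    by_cases h0 : MvPowerSeries.coeff α (schur K lam) = 0
    · rw [h0, mul_zero]
    · rw [if_neg, zero_mul]
      intro hv
      apply hne
      rw [degree_eq_of_coeff_schur_ne_zero h0]
      have := eq_column_of_isVerticalStrip hv
      rw [this, card_column]

theorem hall_E_schurSym (t : K) (lam : YoungDiagram) :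
    hall (E t) (schurSym K lam) = if IsVerticalStrip lam ⊥ then t ^ lam.card else 0 := by
  rw [hall_schurSym]
  change schurCoeff (ESeries t) lam = _
  rw [ESeries_eq_schurSeries, schurCoeff_schurSeries]

/-! ### The branching rule -/

/-- By commutativity the extra variable may also be split off at the outer rim λ/ν instead of at the
inner rim. -/
theorem dualGCoeff_consExp' (b : ℕ) (β : ℕ →₀ ℕ) :
    dualGCoeff K (consExp b β) = dualGCoeff K β * columnIndicator K b := by
  rw [dualGCoeff_consExp, (dualGCoeff_commute b β).eq]

/-- The branching rule is the top-degree part of the one for g_λ: homogeneity retains only the ν for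
which c(λ/ν) attains its maximum |λ/ν|. -/
theorem specialize_schurSym (s : K) (lam : YoungDiagram) :
    specialize s (schurSym K lam) =
      ∑ nu ∈ Finset.Icc ⊥ lam with numColumns lam nu = skewSize lam nu,
        s ^ skewSize lam nu • schurSym K nu := by
  ext β
  rw [coeff_specialize s (f := schurSym K lam) (isDegreeBound_schur lam),
    AddSubmonoidClass.coe_finsetSum, map_sum]
  have hl : ∀ b, MvPowerSeries.coeff (consExp b β) (schurSym K lam : MvPowerSeries ℕ K) =
      ∑ nu ∈ Finset.Icc ⊥ lam, if b = numColumns lam nu then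
        (if b + β.degree = lam.card then dualGCoeff K β ⊥ nu else 0) else 0 := by
    intro b
    change MvPowerSeries.coeff (consExp b β) (schur K lam) = _
    rw [coeff_schur_eq_ite, degree_consExp, dualGCoeff_consExp', IncidenceAlgebra.mul_apply]
    split_ifs with h
    · refine Finset.sum_congr rfl fun nu hnu => ?_
      rw [columnIndicator_apply _ (Finset.mem_Icc.1 hnu).2, mul_ite, mul_one, mul_zero]
      simp only [eq_comm]
    · simp
  simp only [hl, Finset.mul_sum]
  rw [Finset.sum_comm, Finset.sum_filter]
  refine Finset.sum_congr rfl fun nu hnu => ?_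
  have hle := (Finset.mem_Icc.1 hnu).2
  have hcard := skewSize_add_card hle
  have hc := numColumns_le_skewSize lam nu
  rw [Finset.sum_eq_single_of_mem (numColumns lam nu) (Finset.mem_range.2 (by omega))
    (fun b _ hb => by rw [if_neg hb, mul_zero]), if_pos rfl]
  have hr : MvPowerSeries.coeff β ((s ^ skewSize lam nu • schurSym K nu : SymFun K) :
      MvPowerSeries ℕ K) = s ^ skewSize lam nu *
        if β.degree = nu.card then dualGCoeff K β ⊥ nu else 0 := by
    rw [← coeff_schur_eq_ite]
    rfl
  -- A nonzero coefficient forces |β| ≤ |ν|. Together with c(λ/ν) ≤ |λ/ν|, the condition c(λ/ν) +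
  -- |β| = |λ| forces equality in both.
  by_cases h0 : dualGCoeff K β ⊥ nu = 0
  · rw [hr, h0]
    simp
  · have hd : β.degree ≤ nu.card := by
      rw [dualGCoeff_apply _ bot_le] at h0
      rw [← skewSize_bot]
      exact degree_le_of_coeff_dualG_ne_zero h0
    split_ifs with h1 h2 h2
    · rw [hr, if_pos (by omega), h2]
    · omega
    · rw [hr, if_neg (by omega), mul_zero, mul_zero]
    · simp

/-! ### The pairing with `E(t)` -/

theorem coeff_zero_schur (lam : YoungDiagram) :
    MvPowerSeries.coeff 0 (schur K lam) = if lam = ⊥ then 1 else 0 := by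
  rw [coeff_schur_eq_ite, dualGCoeff_zero, IncidenceAlgebra.one_apply, map_zero]
  by_cases h : lam = ⊥
  · subst h
    rw [if_pos rfl, if_pos (show 0 = (⊥ : YoungDiagram).card from rfl)]
  · rw [if_neg (Ne.symm h), if_neg h, ite_self]

theorem hall_E_specialize_schurSym (t : K) (lam : YoungDiagram) :
    hall (E t) (specialize (-t) (schurSym K lam)) = if lam = ⊥ then 1 else 0 := by
  rw [specialize_schurSym, ← hallLinear_apply, map_sum]
  have h1 : ∀ nu, hallLinear (E t) ((-t) ^ skewSize lam nu • schurSym K nu) =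
      if IsVerticalStrip nu ⊥ then (-t) ^ skewSize lam nu * t ^ nu.card else 0 := by
    intro nu
    rw [map_smul, hallLinear_apply, hall_E_schurSym, smul_eq_mul, mul_ite, mul_zero]
  simp only [h1]
  have h2 : (∑ nu ∈ Finset.Icc ⊥ lam with numColumns lam nu = skewSize lam nu,
      if IsVerticalStrip nu ⊥ then (-t) ^ skewSize lam nu * t ^ nu.card else 0) =
      ∑ nu ∈ Finset.Icc ⊥ lam with IsVerticalStrip nu ⊥,
        if numColumns lam nu = skewSize lam nu then (-t) ^ skewSize lam nu * t ^ nu.card else 0 := by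
    rw [Finset.sum_filter, Finset.sum_filter]
    exact Finset.sum_congr rfl fun nu _ => by split_ifs <;> rfl
  have h3 : ∀ k, numColumns lam (column k) = skewSize lam (column k) ↔
      lam.colLen 0 ≤ k + 1 ∧ lam.colLen 1 ≤ 1 := by
    intro k
    rw [numColumns_eq_skewSize_iff]
    constructor
    · intro h
      exact ⟨by simpa [colLen_column] using h 0, by simpa [colLen_column] using h 1⟩
    · intro h j
      rw [colLen_column]
      split_ifs with hj
      · rw [hj]
        exact h.1
      · have := lam.colLen_anti 1 j (by omega)
        omega
  rw [h2, sum_isVerticalStrip_bot]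
  simp only [h3, card_column]
  rcases Nat.eq_zero_or_eq_succ_pred (lam.colLen 0) with h0 | h0
  · have hbot : lam = ⊥ := by
      rw [← column_zero, ← h0]
      refine eq_column_of_colLen_one ?_
      have := lam.colLen_anti 0 1 (by omega)
      omega
    subst hbot
    have hs : skewSize ⊥ (column 0) = 0 := by rw [column_zero, skewSize_bot]; rfl
    simp [colLen_bot, hs]
  · generalize (lam.colLen 0).pred = m at h0
    have hbot : lam ≠ ⊥ := by
      rintro rfl
      rw [colLen_bot] at h0
      omega
    -- Only the columns of length m and m + 1 = ℓ(λ) can have a horizontal strip as complement.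
    -- Their sizes |λ/ν| differ by one, so the two terms have opposite signs and cancel.
    rw [if_neg hbot, h0, Finset.sum_range_succ, Finset.sum_range_succ, Finset.sum_eq_zero, zero_add]
    · by_cases h1 : lam.colLen 1 ≤ 1
      · rw [if_pos ⟨by omega, h1⟩, if_pos ⟨by omega, h1⟩]
        have e1 := skewSize_add_card (column_le_iff.2 (show m ≤ lam.colLen 0 by omega))
        have e2 := skewSize_add_card (column_le_iff.2 (show m + 1 ≤ lam.colLen 0 by omega))
        rw [card_column] at e1 e2
        rw [show skewSize lam (column m) = skewSize lam (column (m + 1)) + 1 by omega]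
        ring
      · rw [if_neg fun h => h1 h.2, if_neg fun h => h1 h.2, add_zero]
    · intro k hk
      rw [Finset.mem_range] at hk
      exact if_neg fun h => by omega

theorem hall_E_specialize (t : K) (f : SymFun K) :
    hall (E t) (specialize (-t) f) = MvPowerSeries.coeff 0 (f : MvPowerSeries ℕ K) := by
  have h : (hallLinear (E t)).comp (specialize (-t)).toLinearMap =
      (MvPowerSeries.coeff 0).comp (SymFun K).val.toLinearMap := by
    refine linearMap_ext_schurSym fun lam => ?_
    change hall (E t) (specialize (-t) (schurSym K lam)) = MvPowerSeries.coeff 0 (schur K lam)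
    rw [hall_E_specialize_schurSym, coeff_zero_schur]
  exact LinearMap.congr_fun h f

/-! ### `E(t)^⊥` is inverse to a specialization -/

/-- Specialization in x commutes with extracting the coefficient of y^β, and pairing with E(t) then
leaves the constant term in x, which is the coefficient of f itself. -/
theorem perp_E_specialize (t : K) (f : SymFun K) : perp (E t) (specialize (-t) f) = f := by
  ext β
  rw [coeff_perp, symCoeff_specialize, hall_E_specialize, coeff_zero_symCoeff]

/-- F^⊥ acts on the alphabet x, so a variable of y may be specialized before or after it, by
linearity of the pairing. This turns the one-sided inverse of `perp_E_specialize` into a two-sided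
one. -/
theorem specialize_perp (s : K) (F : SymSeries K) (f : SymFun K) :
    specialize s (perp F f) = perp F (specialize s f) := by
  obtain ⟨M, hM⟩ := f.2.2
  obtain ⟨N, hN⟩ := (perp F f).2.2
  have hM' : IsDegreeBound (max M N) (f : MvPowerSeries ℕ K) :=
    IsDegreeBound.mono hM (le_max_left M N)
  have hN' : IsDegreeBound (max M N) (perp F f : MvPowerSeries ℕ K) :=
    IsDegreeBound.mono hN (le_max_right M N)
  ext β
  rw [coeff_specialize s hN', coeff_perp, symCoeff_specialize_eq_sum s hM', ← hallLinear_apply,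
    map_sum]
  exact Finset.sum_congr rfl fun b _ => by rw [map_smul, coeff_perp, smul_eq_mul, hallLinear_apply]

theorem specialize_perp_E (t : K) (f : SymFun K) : specialize (-t) (perp (E t) f) = f := by
  rw [specialize_perp, perp_E_specialize]

/-- `E(t)^⊥` as an automorphism of the algebra of symmetric functions. -/
def perpEquiv (t : K) : SymFun K ≃ₐ[K] SymFun K :=
  (AlgEquiv.ofBijective (specialize (-t))
    ⟨Function.LeftInverse.injective (perp_E_specialize t),
      Function.RightInverse.surjective (specialize_perp_E t)⟩).symm

theorem perpEquiv_apply (t : K) (f : SymFun K) : perpEquiv t f = perp (E t) f := by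
  rw [perpEquiv, AlgEquiv.symm_apply_eq]
  exact (specialize_perp_E t f).symm

/-! ### The action of `E(t)^⊥` on dual stable Grothendieck polynomials -/

open Classical in
/-- `g_{λ/μ}` as an element of `Λ`, and `0` unless `μ ⊂ λ`. -/
def dualGSym (K : Type*) [CommRing K] (lam mu : YoungDiagram) : SymFun K :=
  if h : mu ≤ lam then ⟨dualG K lam mu, dualG_mem h⟩ else 0

theorem dualGSym_of_le {lam mu : YoungDiagram} (h : mu ≤ lam) :
    dualGSym K lam mu = ⟨dualG K lam mu, dualG_mem h⟩ := dif_pos h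

theorem coe_dualGSym {lam mu : YoungDiagram} (h : mu ≤ lam) :
    (dualGSym K lam mu : MvPowerSeries ℕ K) = dualG K lam mu := by
  rw [dualGSym_of_le h]

theorem coeff_specialize_dualGSym (s : K) {lam mu : YoungDiagram} (h : mu ≤ lam) (β : ℕ →₀ ℕ) :
    MvPowerSeries.coeff β (specialize s (dualGSym K lam mu) : MvPowerSeries ℕ K) =
      (columnWeight s * dualGCoeff K β) mu lam := by
  have hN : IsDegreeBound (skewSize lam mu) (dualGSym K lam mu : MvPowerSeries ℕ K) := by
    rw [coe_dualGSym h]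
    exact fun α hα => degree_le_of_coeff_dualG_ne_zero hα
  rw [coeff_specialize s hN, coe_dualGSym h]
  simp only [← dualGCoeff_apply _ h, dualGCoeff_consExp, IncidenceAlgebra.mul_apply, Finset.mul_sum]
  rw [Finset.sum_comm]
  refine Finset.sum_congr rfl fun nu hnu => ?_
  have hnu := Finset.mem_Icc.1 hnu
  have hlt : numColumns nu mu < skewSize lam mu + 1 := by
    have h1 := numColumns_le_skewSize nu mu
    have h2 := skewSize_add_card hnu.1
    have h3 := skewSize_add_card hnu.2
    have h4 := skewSize_add_card h
    omega
  rw [Finset.sum_eq_single_of_mem _ (Finset.mem_range.2 hlt), columnIndicator_apply _ hnu.1,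
    if_pos rfl, one_mul, columnWeight_apply _ hnu.1]
  intro b _ hb
  rw [columnIndicator_apply _ hnu.1, if_neg (Ne.symm hb), zero_mul, mul_zero]

theorem coeff_specialize_dualGSym' (s : K) {lam mu : YoungDiagram} (h : mu ≤ lam) (β : ℕ →₀ ℕ) :
    MvPowerSeries.coeff β (specialize s (dualGSym K lam mu) : MvPowerSeries ℕ K) =
      (dualGCoeff K β * columnWeight s) mu lam := by
  have hN : IsDegreeBound (skewSize lam mu) (dualGSym K lam mu : MvPowerSeries ℕ K) := by
    rw [coe_dualGSym h]
    exact fun α hα => degree_le_of_coeff_dualG_ne_zero hα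
  rw [coeff_specialize s hN, coe_dualGSym h]
  simp only [← dualGCoeff_apply _ h, dualGCoeff_consExp', IncidenceAlgebra.mul_apply, Finset.mul_sum]
  rw [Finset.sum_comm]
  refine Finset.sum_congr rfl fun nu hnu => ?_
  have hnu := Finset.mem_Icc.1 hnu
  have hlt : numColumns lam nu < skewSize lam mu + 1 := by
    have h1 := numColumns_le_skewSize lam nu
    have h2 := skewSize_add_card hnu.1
    have h3 := skewSize_add_card hnu.2
    have h4 := skewSize_add_card h
    omega
  rw [Finset.sum_eq_single_of_mem _ (Finset.mem_range.2 hlt), columnIndicator_apply _ hnu.2,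
    if_pos rfl, mul_one, mul_comm, columnWeight_apply _ hnu.2]
  intro b _ hb
  rw [columnIndicator_apply _ hnu.2, if_neg (Ne.symm hb), mul_zero, mul_zero]

theorem perp_E_dualGSym_eq_sum_left (t : K) {lam mu : YoungDiagram} (h : mu ≤ lam) :
    perp (E t) (dualGSym K lam mu) =
      ∑ nu ∈ Finset.Icc mu lam, stripWeight t nu lam • dualGSym K nu mu := by
  -- Writing the right side as E(t)^⊥ of its own specialization leaves g_{λ/μ} to be identified with
  -- that specialization, which the incidence algebra computes.
  conv_rhs => rw [← perp_E_specialize t (∑ nu ∈ _, _)]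
  congr 1
  rw [map_sum]
  ext β
  rw [AddSubmonoidClass.coe_finsetSum, map_sum, coe_dualGSym h, ← dualGCoeff_apply β h]
  have key : dualGCoeff K β = dualGCoeff K β * columnWeight (-t) * stripWeight t := by
    rw [mul_assoc, columnWeight_neg_mul_stripWeight, mul_one]
  rw [key, IncidenceAlgebra.mul_apply]
  refine Finset.sum_congr rfl fun nu hnu => ?_
  rw [← coeff_specialize_dualGSym' _ (Finset.mem_Icc.1 hnu).1, map_smul, mul_comm]
  rfl

theorem perp_E_dualGSym_eq_sum_right (t : K) {lam mu : YoungDiagram} (h : mu ≤ lam) :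
    perp (E t) (dualGSym K lam mu) =
      ∑ nu ∈ Finset.Icc mu lam, stripWeight t mu nu • dualGSym K lam nu := by
  conv_rhs => rw [← perp_E_specialize t (∑ nu ∈ _, _)]
  congr 1
  rw [map_sum]
  ext β
  rw [AddSubmonoidClass.coe_finsetSum, map_sum, coe_dualGSym h, ← dualGCoeff_apply β h]
  have key : dualGCoeff K β = stripWeight t * (columnWeight (-t) * dualGCoeff K β) := by
    rw [← mul_assoc, stripWeight_mul_columnWeight_neg, one_mul]
  rw [key, IncidenceAlgebra.mul_apply]
  refine Finset.sum_congr rfl fun nu hnu => ?_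
  rw [← coeff_specialize_dualGSym _ (Finset.mem_Icc.1 hnu).2, map_smul]
  rfl

theorem coe_perp_E_dualG_left (t : K) {lam mu : YoungDiagram} (h : mu ≤ lam) :
    (perp (E t) ⟨dualG K lam mu, dualG_mem h⟩ : MvPowerSeries ℕ K) =
      ∑ nu ∈ Finset.Icc mu lam with IsVerticalStrip lam nu,
        stripCoeff t lam nu • dualG K nu mu := by
  rw [← dualGSym_of_le h, perp_E_dualGSym_eq_sum_left t h, AddSubmonoidClass.coe_finsetSum,
    Finset.sum_filter]
  refine Finset.sum_congr rfl fun nu hnu => ?_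
  have hnu := Finset.mem_Icc.1 hnu
  rw [stripWeight_apply t hnu.2, SetLike.val_smul, coe_dualGSym hnu.1, ite_smul, zero_smul]

theorem coe_perp_E_dualG_right (t : K) {lam mu : YoungDiagram} (h : mu ≤ lam) :
    (perp (E t) ⟨dualG K lam mu, dualG_mem h⟩ : MvPowerSeries ℕ K) =
      ∑ nu ∈ Finset.Icc mu lam with IsVerticalStrip nu mu,
        stripCoeff t nu mu • dualG K lam nu := by
  rw [← dualGSym_of_le h, perp_E_dualGSym_eq_sum_right t h, AddSubmonoidClass.coe_finsetSum,
    Finset.sum_filter]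
  refine Finset.sum_congr rfl fun nu hnu => ?_
  have hnu := Finset.mem_Icc.1 hnu
  rw [stripWeight_apply t hnu.1, SetLike.val_smul, coe_dualGSym hnu.2, ite_smul, zero_smul]

/-! ### Straight shapes and the final statement. -/

theorem stripCoeff_column (t : K) (k : ℕ) : stripCoeff t (column k) ⊥ = columnCoeff t k := by
  rw [stripCoeff_eq_prod t (n := 1) (by simp [colLen_column])]
  simp [colLen_column, colLen_bot]

/-- The vertical strips over the empty diagram are the columns (1^k). The term k = 0 is g_λ, and it
is separated because `columnCoeff` has its exceptional value 1 there. -/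
theorem coe_perp_E_dualG_bot (t : K) (lam : YoungDiagram) :
    (perp (E t) ⟨dualG K lam ⊥, dualG_mem bot_le⟩ : MvPowerSeries ℕ K) =
      dualG K lam ⊥ + ∑ k ∈ Finset.Icc 1 (lam.colLen 0),
        (t * (t + 1) ^ (k - 1)) • dualG K lam (column k) := by
  rw [coe_perp_E_dualG_right t bot_le, sum_isVerticalStrip_bot, Finset.range_eq_Ico,
    Finset.sum_eq_sum_Ico_succ_bot (Nat.succ_pos _), Nat.succ_eq_add_one,
    Finset.Ico_add_one_right_eq_Icc]
  simp only [stripCoeff_column]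
  congr 1
  · rw [column_zero, columnCoeff, if_pos rfl, one_smul]
  · refine Finset.sum_congr rfl fun k hk => ?_
    rw [Finset.mem_Icc] at hk
    rw [columnCoeff, if_neg (by omega)]

end Pairing

end

end DualGrothendieck

theorem mainTheorem9 {K : Type*} [CommRing K] (t : K) :
    -- `E(t)^⊥` is an automorphism of the `K`-algebra `Λ`
    (∃ φ : DualGrothendieck.SymFun K ≃ₐ[K] DualGrothendieck.SymFun K,
      ∀ f, φ f = DualGrothendieck.perp (DualGrothendieck.E t) f) ∧
    -- skew shapes
    (∀ lam mu : YoungDiagram, mu ≤ lam →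
      ∃ hg : DualGrothendieck.dualG K lam mu ∈ DualGrothendieck.SymFun K,
        (DualGrothendieck.perp (DualGrothendieck.E t) ⟨DualGrothendieck.dualG K lam mu, hg⟩ :
            MvPowerSeries ℕ K) =
          ∑ nu ∈ Finset.Icc mu lam with DualGrothendieck.IsVerticalStrip lam nu,
            DualGrothendieck.stripCoeff t lam nu • DualGrothendieck.dualG K nu mu ∧
        (DualGrothendieck.perp (DualGrothendieck.E t) ⟨DualGrothendieck.dualG K lam mu, hg⟩ :
            MvPowerSeries ℕ K) =
          ∑ nu ∈ Finset.Icc mu lam with DualGrothendieck.IsVerticalStrip nu mu,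
            DualGrothendieck.stripCoeff t nu mu • DualGrothendieck.dualG K lam nu) ∧
    -- straight shapes, `g_λ = g_{λ/∅}`
    (∀ lam : YoungDiagram,
      ∃ hg : DualGrothendieck.dualG K lam ⊥ ∈ DualGrothendieck.SymFun K,
        (DualGrothendieck.perp (DualGrothendieck.E t) ⟨DualGrothendieck.dualG K lam ⊥, hg⟩ :
            MvPowerSeries ℕ K) =
          ∑ nu ∈ Finset.Icc ⊥ lam with DualGrothendieck.IsVerticalStrip lam nu,
            DualGrothendieck.stripCoeff t lam nu • DualGrothendieck.dualG K nu ⊥ ∧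
        (DualGrothendieck.perp (DualGrothendieck.E t) ⟨DualGrothendieck.dualG K lam ⊥, hg⟩ :
            MvPowerSeries ℕ K) =
          DualGrothendieck.dualG K lam ⊥ +
            ∑ k ∈ Finset.Icc 1 (lam.colLen 0),
              (t * (t + 1) ^ (k - 1)) •
                DualGrothendieck.dualG K lam (DualGrothendieck.column k)) :=
  ⟨⟨DualGrothendieck.perpEquiv t, DualGrothendieck.perpEquiv_apply t⟩,
    fun _ _ h => ⟨DualGrothendieck.dualG_mem h, DualGrothendieck.coe_perp_E_dualG_left t h,
      DualGrothendieck.coe_perp_E_dualG_right t h⟩,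
    fun lam => ⟨DualGrothendieck.dualG_mem bot_le, DualGrothendieck.coe_perp_E_dualG_left t bot_le,
      DualGrothendieck.coe_perp_E_dualG_bot t lam⟩⟩
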